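/- **Setting.** Let $\{p,q\}$ be a hyperbolic Schläfli symbol ($p,q\ge 3$, $\frac1p+\frac1q<\frac12$) with $p>3$, and consider the regular tiling of the hyperbolic plane by $p$-gons, $q$ of which meet at each vertex. For a finite set $B$ of tiles (a *patch*), place one tensor on each tile of $B$; the sides shared by two tiles of $B$ are the internal edges (bond dimension $b$), the sides between a tile of $B$ and a tile outside $B$ are the external edges or boundary sites (physical dimension $a$), and each tensor has one logical leg (dimension $d$). Let $n=n(B)$ be the number of boundary sites. The patch is *connected* if its tiles are connected through internal edges. The tensor on tile $i$ is the vector $U_i|0\rangle_i$, where $|0\rangle_i$ is any fixed unit vector in the tensor product of the spaces of all legs of the tensor, and the $U_i$ are independent Haar-random unitaries. The *random tensor network (RTN) state* $|\psi\rangle\in(\mathbb C^a)^{\otimes n}$ is obtained by contracting all internal edges with maximally entangled pairs and projecting the logical legs onto a unit bulk state $|\Phi\rangle\in(\mathbb C^d)^{\otimes |B|}$. For a unit reference state $|\phi\rangle\in(\mathbb C^a)^{\otimes n}$, its inverse effective dimension is $$\frac1{D_{\mathrm{eff}}}=a^n\,\frac{\mathbb E\big[|\langle\psi|\phi\rangle|^4\big]}{\big(\mathbb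 E[\langle\psi|\psi\rangle]\big)^2}.$$ The *layered patches* $P_0\subset P_1\subset\cdots$ are defined by vertex inflation: $P_0$ is a single tile and $P_{L+1}$ consists of all tiles that share a vertex with a tile of $P_L$. **Claim.** Let $a\ge 2$. In the scaling limit $n\to\infty$, RTN states on the tiling equilibrate perfectly, $1/D_{\mathrm{eff}}\to0$, for any (finite or infinite) choice of bond and logical dimensions $b,d\ge 1$. Precisely: 1. For every $\varepsilon>0$ there is an $N$ such that $1/D_{\mathrm{eff}}<\varepsilon$ for all connected finite patches $B$ with $n(B)\ge N$, all integers $b,d\ge1$, and all unit vectors $|\Phi\rangle$, $|\phi\rangle$, $|0\rangle_i$. (The convergence is uniform in $b$ and $d$, so it also covers the limits $b\to\infty$ and $d\to\infty$, taken before or together with $n\to\infty$.) 2. Every layered patch $P_L$ is connected and $n(P_L)\to\infty$ as $L\to\infty$. Consequently $1/D_{\mathrm{eff}}\to0$ along $(P_L)_L$, for any choice of $b_L,d_L\ge1$ and of unit vectors. -/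

import Mathlib

open MeasureTheory Filter Topology

noncomputable section

/-! ## Haar-random unitaries -/

/-- The Borel `σ`-algebra on the unitary group `U(ι)`. -/
instance unitaryGroupMeasurableSpace (ι : Type) [Fintype ι] [DecidableEq ι] :
    MeasurableSpace (Matrix.unitaryGroup ι ℂ) := borel _

instance unitaryGroupBorelSpace (ι : Type) [Fintype ι] [DecidableEq ι] :
    BorelSpace (Matrix.unitaryGroup ι ℂ) := ⟨rfl⟩

instance unitaryGroupCompactSpace (ι : Type) [Fintype ι] [DecidableEq ι] :
    CompactSpace (Matrix.unitaryGroup ι ℂ) := by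
  have hK : IsCompact (Set.univ.pi fun _ : ι => Set.univ.pi fun _ : ι =>
      Metric.closedBall (0 : ℂ) 1) :=
    isCompact_univ_pi fun _ => isCompact_univ_pi fun _ => isCompact_closedBall 0 1
  have hc : IsClosed (unitary (Matrix ι ι ℂ) : Set (Matrix ι ι ℂ)) := isClosed_unitary
  have hU : IsCompact (unitary (Matrix ι ι ℂ) : Set (Matrix ι ι ℂ)) := by
    refine IsCompact.of_isClosed_subset hK hc ?_
    intro U hU i _ j _
    simpa using entry_norm_bound_of_unitary hU i j
  exact isCompact_iff_compactSpace.mp hU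

/-- The Haar probability measure on the (compact) unitary group `U(ι)`: the Haar measure
of total mass `1` (circular unitary ensemble). -/
def haarUnitary (ι : Type) [Fintype ι] [DecidableEq ι] :
    Measure (Matrix.unitaryGroup ι ℂ) :=
  Measure.haarMeasure ⊤

/-! ## Random tensor networks

A tensor network lives on a finite graph with vertex set `V` (one tensor per vertex), internal
edges given by a simple graph `G` on `V`, and external edges (physical sites) indexed by `X`, the
external edge `x` being attached to the vertex `site x`.  Physical, bond and logical dimensions are
`a`, `b`, `d`. -/

/-- Basis labels of the Hilbert space of the tensor at `v`: one label in `Fin a` for each external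
edge at `v`, one label in `Fin b` for each internal edge at `v`, and a logical label in `Fin d`. -/
abbrev LegIndex {V X : Type} (G : SimpleGraph V) (site : X → V) (a b d : ℕ) (v : V) : Type :=
  ({x : X // site x = v} → Fin a) × (G.incidenceSet v → Fin b) × Fin d

open Classical in
/-- Contraction of the tensors `T v` over all internal edges (with the unnormalised EPR pairs
`∑ₖ ⟨k k|`) and projection of the logical legs onto the bulk state `Φ`. The result is a vector in
`(ℂ^a)^{⊗ X}`. -/
def tensorNetworkState {V X : Type} [Fintype V] [Fintype X] (G : SimpleGraph V) (site : X → V)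
    (a b d : ℕ) (T : (v : V) → LegIndex G site a b d v → ℂ)
    (Φ : EuclideanSpace ℂ (V → Fin d)) : EuclideanSpace ℂ (X → Fin a) :=
  WithLp.toLp 2 fun s =>
    ∑ k : G.edgeSet → Fin b, ∑ l : V → Fin d,
      star (Φ l) *
        ∏ v, T v (fun x => s x.1, fun e => k ⟨e.1, e.2.1⟩, l v)

open Classical in
/-- The tensor network state whose tensor at `v` is `U v |0⟩_v`, with `|0⟩_v = ref v`. -/
def rtnState {V X : Type} [Fintype V] [Fintype X] (G : SimpleGraph V) (site : X → V)
    (a b d : ℕ) (ref : (v : V) → EuclideanSpace ℂ (LegIndex G site a b d v))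
    (Φ : EuclideanSpace ℂ (V → Fin d))
    (U : (v : V) → Matrix.unitaryGroup (LegIndex G site a b d v) ℂ) :
    EuclideanSpace ℂ (X → Fin a) :=
  tensorNetworkState G site a b d
    (fun v => (U v : Matrix (LegIndex G site a b d v) (LegIndex G site a b d v) ℂ).mulVec (ref v)) Φ

open Classical in
/-- The law of the tensors of a random tensor network: independent Haar-random unitaries, one for
each vertex. -/
def rtnMeasure {V X : Type} [Fintype V] [Fintype X] (G : SimpleGraph V) (site : X → V)
    (a b d : ℕ) : Measure ((v : V) → Matrix.unitaryGroup (LegIndex G site a b d v) ℂ) :=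
  Measure.pi fun v => haarUnitary (LegIndex G site a b d v)

open Classical in
/-- The inverse effective dimension `1 / D_eff = a ^ n * 𝔼[|⟨ψ|φ⟩|⁴] / (𝔼[⟨ψ|ψ⟩])²` of the random
tensor network state `ψ`, with `n` the number of external edges and `φ` the reference state. -/
def invEffDim {V X : Type} [Fintype V] [Fintype X] (G : SimpleGraph V) (site : X → V)
    (a b d : ℕ) (ref : (v : V) → EuclideanSpace ℂ (LegIndex G site a b d v))
    (Φ : EuclideanSpace ℂ (V → Fin d)) (φ : EuclideanSpace ℂ (X → Fin a)) : ℝ :=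
  (a : ℝ) ^ Fintype.card X *
    (∫ U, ‖inner ℂ (rtnState G site a b d ref Φ U) φ‖ ^ 4 ∂(rtnMeasure G site a b d)) /
    (∫ U, ‖rtnState G site a b d ref Φ U‖ ^ 2 ∂(rtnMeasure G site a b d)) ^ 2

open Classical in
/-- The reference vectors of the tensors, the bulk state and the boundary reference state are all
unit vectors. -/
def AreUnitVectors {V X : Type} [Fintype V] [Fintype X] (G : SimpleGraph V) (site : X → V)
    (a b d : ℕ) (ref : (v : V) → EuclideanSpace ℂ (LegIndex G site a b d v))
    (Φ : EuclideanSpace ℂ (V → Fin d)) (φ : EuclideanSpace ℂ (X → Fin a)) : Prop :=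
  (∀ v, ‖ref v‖ = 1) ∧ ‖Φ‖ = 1 ∧ ‖φ‖ = 1

/-! ## Regular hyperbolic tilings

The regular tiling `{p, q}` (regular `p`-gons, `q` of them at each vertex) is described by its
group of orientation-preserving symmetries, the von Dyck group
`⟨x, y | x ^ p = y ^ q = (x y) ^ 2 = 1⟩`, where `x` rotates by `2π/p` about the centre of a tile and
`y` rotates by `2π/q` about a vertex of that tile, so that `x y` is the half-turn about the midpoint
of one of its edges. This group acts simply transitively on the darts of the tiling, that is, on
the pairs of a tile and one of its sides: the group element `g` stands for the image under `g` of a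
fixed base dart (the side of the base tile fixed by the half-turn `x y`). Then
* `g * x` is the next side of the same tile, so the tiles are the cosets of `⟨x⟩`;
* `g * (x * y)` is the same side seen from the tile on its other side;
* `g * y ^ j`, `j < q`, lie in the `q` tiles around one vertex of the tile of `g`. -/

/-- The Schläfli symbol `{p, q}` is hyperbolic. -/
def IsHyperbolicSymbol (p q : ℕ) : Prop :=
  3 ≤ p ∧ 3 ≤ q ∧ (1 : ℝ) / p + 1 / q < 1 / 2

/-- The relators `x ^ p`, `y ^ q`, `(x y) ^ 2` in the free group on `x = 0` and `y = 1`. -/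
def vonDyckRels (p q : ℕ) : Set (FreeGroup (Fin 2)) :=
  {FreeGroup.of 0 ^ p, FreeGroup.of 1 ^ q, (FreeGroup.of 0 * FreeGroup.of 1) ^ 2}

/-- The darts (pairs of a tile and one of its sides) of the `{p, q}` tiling, as elements of its
group of orientation-preserving symmetries. -/
abbrev Dart (p q : ℕ) : Type := PresentedGroup (vonDyckRels p q)

/-- Rotation about the centre of the base tile. -/
def faceRot (p q : ℕ) : Dart p q := PresentedGroup.of 0

/-- Rotation about a vertex of the base tile. -/
def vertexRot (p q : ℕ) : Dart p q := PresentedGroup.of 1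

/-- The tiles of the `{p, q}` tiling. -/
abbrev Tile (p q : ℕ) : Type := Dart p q ⧸ Subgroup.zpowers (faceRot p q)

/-- The tile to which a dart belongs. -/
def tileOf {p q : ℕ} (g : Dart p q) : Tile p q := QuotientGroup.mk g

/-- The same side, seen from the other tile containing it. -/
def flipDart {p q : ℕ} (g : Dart p q) : Dart p q := g * (faceRot p q * vertexRot p q)

/-- Two different tiles are adjacent if they have a common side. -/
def tileGraph (p q : ℕ) : SimpleGraph (Tile p q) :=
  SimpleGraph.fromRel fun s t => ∃ g : Dart p q, tileOf g = s ∧ tileOf (flipDart g) = t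

open Classical in
/-- The `p` sides of a tile. -/
def tileDarts {p q : ℕ} (t : Tile p q) : Finset (Dart p q) :=
  (Finset.range p).image fun i => Quotient.out t * faceRot p q ^ i

theorem faceRot_pow (p q : ℕ) : faceRot p q ^ p = 1 := by
  have h : (PresentedGroup.mk (vonDyckRels p q)) (FreeGroup.of 0 ^ p) = 1 :=
    PresentedGroup.one_of_mem (by simp [vonDyckRels])
  simpa [faceRot, PresentedGroup.of] using h

theorem mem_tileDarts {p q : ℕ} (hp : 0 < p) (t : Tile p q) (g : Dart p q) :
    g ∈ tileDarts t ↔ tileOf g = t := by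
  classical
  have ht : (QuotientGroup.mk (Quotient.out t) : Tile p q) = t := Quotient.out_eq t
  constructor
  · intro h
    obtain ⟨i, -, rfl⟩ := Finset.mem_image.mp h
    rw [← ht]
    simp only [ht]
    conv_rhs => rw [← ht]
    exact (QuotientGroup.eq.mpr (by simp)).symm
  · intro h
    have h1 : (Quotient.out t)⁻¹ * g ∈ Subgroup.zpowers (faceRot p q) := by
      rw [← QuotientGroup.eq, ht, ← h]; rfl
    have hfin : IsOfFinOrder (faceRot p q) :=
      isOfFinOrder_iff_pow_eq_one.mpr ⟨p, hp, faceRot_pow p q⟩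
    obtain ⟨k, hk⟩ := (Submonoid.mem_powers_iff _ _).mp
      (hfin.mem_powers_iff_mem_zpowers.mpr h1)
    refine Finset.mem_image.mpr ⟨k % p, Finset.mem_range.mpr (Nat.mod_lt _ hp), ?_⟩
    have h2 : faceRot p q ^ (k % p) = faceRot p q ^ k := by
      conv_rhs => rw [← Nat.mod_add_div k p, pow_add, pow_mul, faceRot_pow, one_pow, mul_one]
    rw [h2, hk]; group

open Classical in
/-- The external edges of a finite patch `B` of tiles: the sides of tiles of `B` beyond which lies
a tile not in `B`. -/
def externalEdges {p q : ℕ} (B : Finset (Tile p q)) : Finset (Dart p q) :=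
  (B.biUnion tileDarts).filter fun g => tileOf (flipDart g) ∉ B

theorem tileOf_mem_of_mem_externalEdges {p q : ℕ} (B : Finset (Tile p q))
    (g : externalEdges B) : tileOf (g : Dart p q) ∈ B := by
  classical
  obtain ⟨h, -⟩ := Finset.mem_filter.mp g.2
  obtain ⟨t, ht, hg⟩ := Finset.mem_biUnion.mp h
  have hp : 0 < p := by
    rcases Nat.eq_zero_or_pos p with h0 | h0
    · subst h0; simp [tileDarts] at hg
    · exact h0
  rw [(mem_tileDarts hp t g).mp hg]; exact ht

/-- The internal graph of a patch: one tensor for each tile, one internal edge for each side that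
is shared by two tiles of the patch. -/
abbrev patchGraph {p q : ℕ} (B : Finset (Tile p q)) : SimpleGraph B :=
  SimpleGraph.comap (fun t : B => (t : Tile p q)) (tileGraph p q)

/-- The tile of a patch to which an external edge is attached. -/
def patchSite {p q : ℕ} (B : Finset (Tile p q)) (g : externalEdges B) : B :=
  ⟨tileOf (g : Dart p q), tileOf_mem_of_mem_externalEdges B g⟩

/-- The inverse effective dimension of the random tensor network on a patch. -/
def patchInvEffDim {p q : ℕ} (B : Finset (Tile p q)) (a b d : ℕ)
    (ref : (v : B) → EuclideanSpace ℂ (LegIndex (patchGraph B) (patchSite B) a b d v))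
    (Φ : EuclideanSpace ℂ (B → Fin d)) (φ : EuclideanSpace ℂ (externalEdges B → Fin a)) : ℝ :=
  invEffDim (patchGraph B) (patchSite B) a b d ref Φ φ

/-- Number of boundary sites of a patch. -/
def numSites {p q : ℕ} (B : Finset (Tile p q)) : ℕ := (externalEdges B).card

open Classical in
/-- One step of vertex inflation: add all tiles having a vertex in common with a tile of `B`. -/
def inflate {p q : ℕ} (B : Finset (Tile p q)) : Finset (Tile p q) :=
  (B.biUnion tileDarts).biUnion fun g =>
    (Finset.range q).image fun j => tileOf (g * vertexRot p q ^ j)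

/-- The patch of `L` layers around the base tile. -/
def layeredPatch (p q : ℕ) (L : ℕ) : Finset (Tile p q) :=
  inflate^[L] {tileOf (1 : Dart p q)}

end

/-! Two inequalities carry the theorem. For every patch `B` with `n` sites, `1/D_eff ≤ 2^|B| / a^n`
(`invEffDim_le`), and `|B| ≤ κ n` with a constant `κ < 1` depending only on `p`, `q`
(`IsHyperbolicSymbol.exists_card_le`). Since `a ≥ 2`, together they give `1/D_eff ≤ (2^(κ-1))^n`, in
which `b` and `d` do not appear.

Moments. A Haar-random unit vector in dimension `D` has second moment `identity / D` and fourth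
moment `(identity + swap) / (D (D + 1))`. An amplitude of the network is a linear functional of the
product of the tensors, so its fourth moment is a sum over the `2^|B|` choices of identity or swap
at each tile, a partition function of Ising type. Cauchy–Schwarz bounds every configuration by the
squared norm of the coefficients, squared. With `E` internal edges this is `b^(2E)`, while `𝔼⟨ψ|ψ⟩`
is `a^n b^E` up to the factors `1/D`. The bond and tensor dimensions cancel and one factor `a^(-n)`
remains.

Isoperimetry. The unit horocyclic field of the hyperbolic plane has constant divergence, so its flux
out of a tile is the tile's area, while its flux through a side is bounded in terms of the side's
length alone. Summing over the tiles of a patch, internal sides cancel and `|B| * D ≤ n * M`, where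
`D` is half the area of a tile and `M` bounds half the flux through a side
(`IsTileFlow.card_mul_le`). For `p > 3`, hyperbolic trigonometry gives `M < D`
(`IsHyperbolicSymbol.arccos_lt`). The field is pulled back to the abstract von Dyck group along its
representation by Möbius transformations. Faithfulness of the representation is never needed, only
that the face rotation has order exactly `p`. -/

noncomputable section

/-! ## Moments of Haar-random vectors -/

section HaarMoments

variable {ι : Type} [Fintype ι] [DecidableEq ι]

instance haarUnitary_isProbabilityMeasure : IsProbabilityMeasure (haarUnitary ι) :=
  ⟨by simpa [haarUnitary] using
    Measure.haarMeasure_self (K₀ := (⊤ : TopologicalSpace.PositiveCompacts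
      (Matrix.unitaryGroup ι ℂ)))⟩

instance haarUnitary_isMulLeftInvariant : (haarUnitary ι).IsMulLeftInvariant := by
  unfold haarUnitary; infer_instance

/-- The image `U r` of a vector under a unitary matrix. -/
def unitaryVec (r : ι → ℂ) (U : Matrix.unitaryGroup ι ℂ) : ι → ℂ :=
  (U : Matrix ι ι ℂ).mulVec r

theorem continuous_unitaryVec_apply (r : ι → ℂ) (i : ι) :
    Continuous fun U => unitaryVec r U i := by
  unfold unitaryVec Matrix.mulVec dotProduct
  refine continuous_finsetSum _ fun j _ => ?_
  exact (continuous_subtype_val.matrix_elem i j).mul continuous_const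

theorem Continuous.integrable_haarUnitary {E : Type*} [NormedAddCommGroup E]
    {f : Matrix.unitaryGroup ι ℂ → E} (hf : Continuous f) : Integrable f (haarUnitary ι) :=
  hf.integrable_of_hasCompactSupport (HasCompactSupport.of_compactSpace f)

/-- Left invariance of Haar measure: the law of `U r` does not change under a fixed unitary. Every
relation between moments below comes from a suitable choice of `V`. -/
theorem integral_unitaryVec_mulVec {E : Type*} [NormedAddCommGroup E] [NormedSpace ℝ E]
    (r : ι → ℂ) (F : (ι → ℂ) → E) (V : Matrix.unitaryGroup ι ℂ) :
    ∫ U, F ((V : Matrix ι ι ℂ).mulVec (unitaryVec r U)) ∂haarUnitary ι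
      = ∫ U, F (unitaryVec r U) ∂haarUnitary ι := by
  rw [← integral_mul_left_eq_self (fun U => F (unitaryVec r U)) V]
  simp [unitaryVec, Matrix.mulVec_mulVec]

theorem sum_unitaryVec_mul_star (r : ι → ℂ) (U : Matrix.unitaryGroup ι ℂ) :
    ∑ i, unitaryVec r U i * star (unitaryVec r U i) = ∑ i, r i * star (r i) := by
  have h : dotProduct (star (unitaryVec r U)) (unitaryVec r U) = dotProduct (star r) r := by
    unfold unitaryVec
    rw [Matrix.star_mulVec, Matrix.dotProduct_mulVec, Matrix.vecMul_vecMul,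
      ← Matrix.star_eq_conjTranspose, (Matrix.mem_unitaryGroup_iff'.mp U.2), Matrix.vecMul_one]
  simpa [dotProduct, mul_comm] using h

/-- The diagonal unitary with entry `I` at `e` and `1` elsewhere. -/
def phaseUnitary (e : ι) : Matrix.unitaryGroup ι ℂ :=
  ⟨Matrix.diagonal fun i => if i = e then Complex.I else 1, by
    rw [Matrix.mem_unitaryGroup_iff, Matrix.star_eq_conjTranspose, Matrix.diagonal_conjTranspose,
      Matrix.diagonal_mul_diagonal, Matrix.diagonal_eq_one]
    funext i
    by_cases h : i = e <;> simp [h]⟩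

theorem phaseUnitary_mulVec (e i : ι) (t : ι → ℂ) :
    (phaseUnitary e : Matrix ι ι ℂ).mulVec t i = (if i = e then Complex.I else 1) * t i := by
  simp [phaseUnitary, Matrix.mulVec_diagonal]

/-- The real reflection of the plane of the basis vectors `a`, `b` with first row `(x, y)`. -/
def planeUnitary (a b : ι) (hab : a ≠ b) (x y : ℝ) (h : x ^ 2 + y ^ 2 = 1) :
    Matrix.unitaryGroup ι ℂ :=
  ⟨Matrix.of fun i => if i = a then (x : ℂ) • Pi.single a 1 + (y : ℂ) • Pi.single b 1
      else if i = b then (y : ℂ) • Pi.single a 1 - (x : ℂ) • Pi.single b 1 else Pi.single i 1, by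
    have h' : (x : ℂ) * x + y * y = 1 := by
      rw [← sq, ← sq]; exact_mod_cast h
    rw [Matrix.mem_unitaryGroup_iff]
    ext i j
    rw [Matrix.mul_apply]
    simp only [Matrix.star_apply, Matrix.of_apply]
    change (dotProduct _ (star _) : ℂ) = _
    by_cases hia : i = a <;> by_cases hib : i = b <;> by_cases hja : j = a <;>
      by_cases hjb : j = b <;> by_cases hij : i = j <;> simp_all [Matrix.one_apply] <;>
      first | linear_combination h' | ring⟩

theorem planeUnitary_mulVec (a b : ι) (hab : a ≠ b) (x y : ℝ) (h : x ^ 2 + y ^ 2 = 1)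
    (t : ι → ℂ) : (planeUnitary a b hab x y h : Matrix ι ι ℂ).mulVec t a = x * t a + y * t b := by
  simp [planeUnitary, Matrix.mulVec, dotProduct, add_mul, Finset.sum_add_distrib, Pi.single_apply]

/-- The moment `𝔼[t_a conj(t_b)]` of the random vector `t = U r`. -/
def haarMoment2 (r : ι → ℂ) (a b : ι) : ℂ :=
  ∫ U, unitaryVec r U a * star (unitaryVec r U b) ∂haarUnitary ι

/-- The moment `𝔼[t_a conj(t_b) t_c conj(t_d)]` of the random vector `t = U r`. -/
def haarMoment4 (r : ι → ℂ) (a b c d : ι) : ℂ :=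
  ∫ U, unitaryVec r U a * star (unitaryVec r U b) *
    (unitaryVec r U c * star (unitaryVec r U d)) ∂haarUnitary ι

theorem continuous_moment2 (r : ι → ℂ) (a b : ι) :
    Continuous fun U => unitaryVec r U a * star (unitaryVec r U b) :=
  (continuous_unitaryVec_apply r a).mul (continuous_unitaryVec_apply r b).star

theorem continuous_moment4 (r : ι → ℂ) (a b c d : ι) :
    Continuous fun U => unitaryVec r U a * star (unitaryVec r U b) *
      (unitaryVec r U c * star (unitaryVec r U d)) :=
  (continuous_moment2 r a b).mul (continuous_moment2 r c d)

/-! ### Constraints on the moments from phase and reflection symmetry -/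

theorem haarMoment2_phase (r : ι → ℂ) (e a b : ι) :
    ((if a = e then Complex.I else 1) * star (if b = e then Complex.I else 1)) *
      haarMoment2 r a b = haarMoment2 r a b := by
  have h := integral_unitaryVec_mulVec r (fun t => t a * star (t b)) (phaseUnitary e)
  simp only [phaseUnitary_mulVec] at h
  rw [haarMoment2, ← integral_const_mul]
  refine (integral_congr_ae (.of_forall fun U => ?_)).trans h
  simp only [star_mul']
  ring

theorem haarMoment4_phase (r : ι → ℂ) (e a b c d : ι) :
    ((if a = e then Complex.I else 1) * star (if b = e then Complex.I else 1) *
      ((if c = e then Complex.I else 1) * star (if d = e then Complex.I else 1))) *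
      haarMoment4 r a b c d = haarMoment4 r a b c d := by
  have h := integral_unitaryVec_mulVec r (fun t => t a * star (t b) * (t c * star (t d)))
    (phaseUnitary e)
  simp only [phaseUnitary_mulVec] at h
  rw [haarMoment4, ← integral_const_mul]
  refine (integral_congr_ae (.of_forall fun U => ?_)).trans h
  simp only [star_mul']
  ring

theorem haarMoment2_eq_zero (r : ι → ℂ) {a b : ι} (hab : a ≠ b) : haarMoment2 r a b = 0 := by
  have h := haarMoment2_phase r a a b
  rw [if_pos rfl, if_neg hab.symm, star_one, mul_one] at h
  have h1 : (Complex.I - 1) * haarMoment2 r a b = 0 := by rw [sub_mul, h]; ring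
  refine (mul_eq_zero.mp h1).resolve_left fun h0 => ?_
  simpa using congrArg Complex.im h0

theorem eq_zero_of_mul_eq_self {w z : ℂ} (hw : w ≠ 1) (h : w * z = z) : z = 0 := by
  have h1 : (w - 1) * z = 0 := by rw [sub_mul, h]; ring
  exact (mul_eq_zero.mp h1).resolve_left (sub_ne_zero.mpr hw)

/-- If the multisets `{a, c}` and `{b, d}` differ, some index `e` has different multiplicities in
them, and the phase `I` at `e` multiplies the moment by a nontrivial power of `I`. A sign `-1` would
miss a difference of two, as for `a = c`; hence the choice of `I`. -/
theorem haarMoment4_eq_zero (r : ι → ℂ) {a b c d : ι}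
    (h : ¬ ((a = b ∧ c = d) ∨ (a = d ∧ b = c))) : haarMoment4 r a b c d = 0 := by
  have hI : Complex.I ≠ 1 := fun h0 => by simpa using congrArg Complex.im h0
  have hI' : -Complex.I ≠ 1 := fun h0 => by simpa using congrArg Complex.im h0
  have hn : (-1 : ℂ) ≠ 1 := by norm_num
  by_cases hab : a = b
  · subst hab
    have hcd : d ≠ c := fun hcd => h (Or.inl ⟨rfl, hcd.symm⟩)
    have hc := haarMoment4_phase r c a a c d
    refine eq_zero_of_mul_eq_self hI ?_
    by_cases hac : a = c <;> simpa [hac, hcd] using hc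
  by_cases had : a = d
  · subst had
    have hbc : c ≠ b := fun hbc => h (Or.inr ⟨rfl, hbc.symm⟩)
    have hb := haarMoment4_phase r b a b c a
    rw [if_neg hab, if_pos rfl, if_neg hbc] at hb
    exact eq_zero_of_mul_eq_self hI' (by simpa using hb)
  · have ha := haarMoment4_phase r a a b c d
    rw [if_pos rfl, if_neg (Ne.symm hab), if_neg (Ne.symm had)] at ha
    by_cases hca : c = a
    · rw [if_pos hca] at ha
      exact eq_zero_of_mul_eq_self hn (by simpa using ha)
    · rw [if_neg hca] at ha
      exact eq_zero_of_mul_eq_self hI (by simpa using ha)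

theorem haarMoment2_self_eq (r : ι → ℂ) (a b : ι) : haarMoment2 r a a = haarMoment2 r b b := by
  rcases eq_or_ne a b with rfl | hab
  · rfl
  have h := integral_unitaryVec_mulVec r (fun t => t a * star (t a))
    (planeUnitary a b hab 0 1 (by norm_num))
  simp only [planeUnitary_mulVec] at h
  simpa [haarMoment2] using h.symm

theorem haarMoment2_eq (r : ι → ℂ) (hr : ∑ i, r i * star (r i) = 1) (a b : ι) :
    haarMoment2 r a b = if a = b then (1 : ℂ) / Fintype.card ι else 0 := by
  split_ifs with hab
  · subst hab
    have h : ∑ i, haarMoment2 r i i = 1 := by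
      unfold haarMoment2
      rw [← integral_finsetSum _ fun i _ => (continuous_moment2 r i i).integrable_haarUnitary]
      simp_rw [sum_unitaryVec_mul_star, hr]
      simp
    rw [Finset.sum_congr rfl fun i _ => haarMoment2_self_eq r i a] at h
    rw [Finset.sum_const, Finset.card_univ, nsmul_eq_mul] at h
    have hc : (Fintype.card ι : ℂ) ≠ 0 := fun h0 => by simp [h0] at h
    field_simp
    linear_combination h
  · exact haarMoment2_eq_zero r hab

theorem haarMoment4_plane (r : ι → ℂ) {a b : ι} (hab : a ≠ b) (x y : ℝ) (h : x ^ 2 + y ^ 2 = 1) :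
    haarMoment4 r a a a a = x ^ 4 * haarMoment4 r a a a a + y ^ 4 * haarMoment4 r b b b b
      + 4 * x ^ 2 * y ^ 2 * haarMoment4 r a a b b := by
  have hV := integral_unitaryVec_mulVec r (fun t => t a * star (t a) * (t a * star (t a)))
    (planeUnitary a b hab x y h)
  simp only [planeUnitary_mulVec] at hV
  have hi := fun i j k l => (continuous_moment4 r i j k l).integrable_haarUnitary
  -- The booleans index the 16 monomials of the expansion. Phase symmetry leaves the two pure ones
  -- and the four equal mixed ones, which produce the factor `4 x² y²`.
  have key : ∀ t : ι → ℂ, (x * t a + y * t b) * star (x * t a + y * t b) *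
      ((x * t a + y * t b) * star (x * t a + y * t b)) =
      ∑ i : Bool, ∑ j : Bool, ∑ k : Bool, ∑ l : Bool,
        ((bif i then (x : ℂ) else y) * (bif j then (x : ℂ) else y) * (bif k then (x : ℂ) else y) *
          (bif l then (x : ℂ) else y)) *
        (t (bif i then a else b) * star (t (bif j then a else b)) *
          (t (bif k then a else b) * star (t (bif l then a else b)))) := by
    intro t
    simp only [Fintype.sum_bool, cond_true, cond_false, star_add, star_mul', Complex.star_def,
      Complex.conj_ofReal]
    ring
  simp_rw [key] at hV
  have hint : ∀ i j k l : Bool, Integrable (fun U =>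
      ((bif i then (x : ℂ) else y) * (bif j then (x : ℂ) else y) * (bif k then (x : ℂ) else y) *
          (bif l then (x : ℂ) else y)) *
        (unitaryVec r U (bif i then a else b) * star (unitaryVec r U (bif j then a else b)) *
          (unitaryVec r U (bif k then a else b) * star (unitaryVec r U (bif l then a else b)))))
      (haarUnitary ι) := fun i j k l => (hi _ _ _ _).const_mul _
  have hsum : ∑ i : Bool, ∑ j : Bool, ∑ k : Bool, ∑ l : Bool,
        ((bif i then (x : ℂ) else y) * (bif j then (x : ℂ) else y) * (bif k then (x : ℂ) else y) *
          (bif l then (x : ℂ) else y)) *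
        haarMoment4 r (bif i then a else b) (bif j then a else b) (bif k then a else b)
          (bif l then a else b) = haarMoment4 r a a a a := by
    rw [show haarMoment4 r a a a a = _ from hV.symm]
    rw [integral_finsetSum _ fun i _ => integrable_finsetSum _ fun j _ =>
      integrable_finsetSum _ fun k _ => integrable_finsetSum _ fun l _ => hint i j k l]
    refine Finset.sum_congr rfl fun i _ => ?_
    rw [integral_finsetSum _ fun j _ =>
      integrable_finsetSum _ fun k _ => integrable_finsetSum _ fun l _ => hint i j k l]
    refine Finset.sum_congr rfl fun j _ => ?_
    rw [integral_finsetSum _ fun k _ => integrable_finsetSum _ fun l _ => hint i j k l]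
    refine Finset.sum_congr rfl fun k _ => ?_
    rw [integral_finsetSum _ fun l _ => hint i j k l]
    refine Finset.sum_congr rfl fun l _ => ?_
    rw [integral_const_mul, haarMoment4]
  have e1 : haarMoment4 r b b a a = haarMoment4 r a a b b :=
    integral_congr_ae (.of_forall fun U => by ring)
  have e2 : haarMoment4 r a b b a = haarMoment4 r a a b b :=
    integral_congr_ae (.of_forall fun U => by ring)
  have e3 : haarMoment4 r b a a b = haarMoment4 r a a b b :=
    integral_congr_ae (.of_forall fun U => by ring)
  have hz := fun {i j k l} => haarMoment4_eq_zero r (a := i) (b := j) (c := k) (d := l)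
  simp only [Fintype.sum_bool, cond_true, cond_false, e1, e2, e3,
    hz (i := a) (j := a) (k := a) (l := b) (by simp [hab]),
    hz (i := a) (j := a) (k := b) (l := a) (by simp [hab, hab.symm]),
    hz (i := a) (j := b) (k := a) (l := a) (by simp [hab, hab.symm]),
    hz (i := b) (j := a) (k := a) (l := a) (by simp [hab.symm]),
    hz (i := b) (j := b) (k := b) (l := a) (by simp [hab.symm]),
    hz (i := b) (j := b) (k := a) (l := b) (by simp [hab, hab.symm]),
    hz (i := b) (j := a) (k := b) (l := b) (by simp [hab, hab.symm]),
    hz (i := a) (j := b) (k := b) (l := b) (by simp [hab]),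
    hz (i := a) (j := b) (k := a) (l := b) (by simp [hab, hab.symm]),
    hz (i := b) (j := a) (k := b) (l := a) (by simp [hab, hab.symm])] at hsum
  linear_combination -hsum

theorem haarMoment4_self_eq (r : ι → ℂ) (a b : ι) :
    haarMoment4 r a a a a = haarMoment4 r b b b b := by
  rcases eq_or_ne a b with rfl | hab
  · rfl
  simpa using haarMoment4_plane r hab 0 1 (by norm_num)

theorem haarMoment4_pair_eq (r : ι → ℂ) (e a b : ι) :
    haarMoment4 r a a b b = (1 + if a = b then 1 else 0) * (haarMoment4 r e e e e / 2) := by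
  split_ifs with hab
  · subst hab
    rw [haarMoment4_self_eq r a e]; ring
  -- Any point of the unit circle with `x y ≠ 0` forces the mixed moment to be half of the pure one,
  -- because `1 - x⁴ - y⁴ = 2 x² y²`; this one is rational.
  · have h := haarMoment4_plane r hab (3 / 5) (4 / 5) (by norm_num)
    rw [haarMoment4_self_eq r b e, haarMoment4_self_eq r a e] at h
    push_cast at h
    linear_combination (-625 / 576) * h

/-- Normalisation: the moments of `|t_i|² |t_j|²` sum to `1`, and the weights `1 + δ_ij` sum to `D²
+ D`. -/
theorem haarMoment4_self (r : ι → ℂ) (hr : ∑ i, r i * star (r i) = 1) (e : ι) :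
    haarMoment4 r e e e e / 2 = 1 / (Fintype.card ι * (Fintype.card ι + 1)) := by
  have h : ∑ i, ∑ j, haarMoment4 r i i j j = 1 := by
    unfold haarMoment4
    rw [← Finset.sum_congr rfl fun i _ => integral_finsetSum _ fun j _ =>
        (continuous_moment4 r i i j j).integrable_haarUnitary,
      ← integral_finsetSum _ fun i _ => integrable_finsetSum _ fun j _ =>
        (continuous_moment4 r i i j j).integrable_haarUnitary]
    simp_rw [← Finset.mul_sum, sum_unitaryVec_mul_star, hr, mul_one, sum_unitaryVec_mul_star, hr]
    simp
  rw [Finset.sum_congr rfl fun i _ => Finset.sum_congr rfl fun j _ =>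
    haarMoment4_pair_eq r e i j] at h
  simp_rw [← Finset.sum_mul, Finset.sum_add_distrib] at h
  simp only [Finset.sum_const, Finset.card_univ, nsmul_eq_mul, Finset.sum_ite_eq,
    Finset.mem_univ, if_true, mul_one] at h
  have hc : (Fintype.card ι : ℂ) * (Fintype.card ι + 1) ≠ 0 := fun h0 => by
    rw [show (Fintype.card ι : ℂ) * Fintype.card ι + Fintype.card ι = 0 by
      linear_combination h0] at h
    simp at h
  rw [eq_div_iff hc]
  linear_combination h

theorem haarMoment4_eq (r : ι → ℂ) (hr : ∑ i, r i * star (r i) = 1) (a b c d : ι) :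
    haarMoment4 r a b c d = ((if a = b ∧ c = d then 1 else 0) + if a = d ∧ b = c then 1 else 0) *
      (1 / (Fintype.card ι * (Fintype.card ι + 1))) := by
  by_cases h1 : a = b ∧ c = d
  · obtain ⟨rfl, rfl⟩ := h1
    rw [haarMoment4_pair_eq r a, haarMoment4_self r hr]
    simp
  by_cases h2 : a = d ∧ b = c
  · obtain ⟨rfl, rfl⟩ := h2
    have e : haarMoment4 r a b b a = haarMoment4 r a a b b :=
      integral_congr_ae (.of_forall fun U => by ring)
    have hab : a ≠ b := fun h => h1 ⟨h, h.symm⟩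
    rw [e, haarMoment4_pair_eq r a, haarMoment4_self r hr]
    simp [hab]
  · rw [haarMoment4_eq_zero r (by tauto), if_neg h1, if_neg h2]
    ring

end HaarMoments

/-! ## Moments of linear functionals of product states -/

section ProductMoments

variable {V : Type} [Fintype V] [DecidableEq V] {ι : V → Type} [∀ v, Fintype (ι v)]
  [∀ v, DecidableEq (ι v)]

/-- The linear functional with coefficients `f` at the product of the vectors `U v (r v)`. -/
def productAmplitude (r : ∀ v, ι v → ℂ) (f : (∀ v, ι v) → ℂ)
    (U : ∀ v, Matrix.unitaryGroup (ι v) ℂ) : ℂ :=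
  ∑ j, f j * ∏ v, unitaryVec (r v) (U v) (j v)

theorem productAmplitude_mul_star (r : ∀ v, ι v → ℂ) (f : (∀ v, ι v) → ℂ)
    (U : ∀ v, Matrix.unitaryGroup (ι v) ℂ) :
    productAmplitude r f U * star (productAmplitude r f U) = ∑ i, ∑ j, f i * star (f j) *
      ∏ v, (unitaryVec (r v) (U v) (i v) * star (unitaryVec (r v) (U v) (j v))) := by
  simp only [productAmplitude, star_sum, star_mul', star_prod, Finset.sum_mul_sum,
    Finset.prod_mul_distrib]
  refine Finset.sum_congr rfl fun i _ => Finset.sum_congr rfl fun j _ => ?_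
  ring

omit [DecidableEq V] in
theorem integrable_prod_haarUnitary {g : ∀ v, Matrix.unitaryGroup (ι v) ℂ → ℂ}
    (hg : ∀ v, Continuous (g v)) :
    Integrable (fun U : ∀ v, Matrix.unitaryGroup (ι v) ℂ => ∏ v, g v (U v))
      (Measure.pi fun v => haarUnitary (ι v)) :=
  Integrable.fintype_prod_dep fun v => (hg v).integrable_haarUnitary

theorem integrable_norm_productAmplitude_sq (r : ∀ v, ι v → ℂ) (f : (∀ v, ι v) → ℂ) :
    Integrable (fun U => ‖productAmplitude r f U‖ ^ 2)
      (Measure.pi fun v => haarUnitary (ι v)) := by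
  have h : Integrable (fun U => productAmplitude r f U * star (productAmplitude r f U))
      (Measure.pi fun v => haarUnitary (ι v)) := by
    simp_rw [productAmplitude_mul_star]
    exact integrable_finsetSum _ fun i _ => integrable_finsetSum _ fun j _ =>
      (integrable_prod_haarUnitary
        (fun v => continuous_moment2 (r v) (i v) (j v))).const_mul (f i * star (f j))
  refine h.re.congr (.of_forall fun U => ?_)
  dsimp only
  rw [Complex.star_def, Complex.mul_conj, Complex.normSq_eq_norm_sq]
  exact Complex.ofReal_re _

theorem integral_productAmplitude_two (r : ∀ v, ι v → ℂ) (hr : ∀ v, ∑ i, r v i * star (r v i) = 1)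
    (f : (∀ v, ι v) → ℂ) :
    ∫ U, productAmplitude r f U * star (productAmplitude r f U)
        ∂(Measure.pi fun v => haarUnitary (ι v)) =
      (∑ j, f j * star (f j)) * ∏ v, ((1 : ℂ) / Fintype.card (ι v)) := by
  simp_rw [productAmplitude_mul_star]
  have hint := fun i j : ∀ v, ι v => (integrable_prod_haarUnitary
    (fun v => continuous_moment2 (r v) (i v) (j v))).const_mul (f i * star (f j))
  rw [integral_finsetSum _ fun i _ => integrable_finsetSum _ fun j _ => hint i j, Finset.sum_mul]
  refine Finset.sum_congr rfl fun i _ => ?_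
  rw [integral_finsetSum _ fun j _ => hint i j, Finset.sum_eq_single i]
  · rw [integral_const_mul, integral_fintype_prod_eq_prod (fun v U =>
      unitaryVec (r v) U (i v) * star (unitaryVec (r v) U (i v)))]
    congr 1
    refine Finset.prod_congr rfl fun v _ => ?_
    rw [← haarMoment2, haarMoment2_eq _ (hr v), if_pos rfl]
  · intro j _ hj
    obtain ⟨v, hv⟩ := Function.ne_iff.mp hj
    rw [integral_const_mul, integral_fintype_prod_eq_prod (fun v U =>
      unitaryVec (r v) U (i v) * star (unitaryVec (r v) U (j v))),
      Finset.prod_eq_zero (Finset.mem_univ v), mul_zero]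
    rw [← haarMoment2, haarMoment2_eq _ (hr v), if_neg hv.symm]
  · simp

/-- Exchange of the components outside `S` of a pair of multi-indices. -/
def mixPair (S : Finset V) : ((∀ v, ι v) × ∀ v, ι v) ≃ ((∀ v, ι v) × ∀ v, ι v) where
  toFun x := (S.piecewise x.1 x.2, S.piecewise x.2 x.1)
  invFun x := (S.piecewise x.1 x.2, S.piecewise x.2 x.1)
  left_inv x := by
    ext v <;> by_cases h : v ∈ S <;> simp [h]
  right_inv x := by
    ext v <;> by_cases h : v ∈ S <;> simp [h]

-- Cauchy–Schwarz, in the form `xy ≤ (x² + y²) / 2`: `mixPair S` permutes the pairs, so both halves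
-- have the same sum.
omit [∀ v, DecidableEq (ι v)] in
theorem norm_sum_mixPair_le (f : (∀ v, ι v) → ℂ) (S : Finset V) :
    ‖∑ x : (∀ v, ι v) × (∀ v, ι v), f x.1 * f x.2 *
      star (f (mixPair S x).1 * f (mixPair S x).2)‖ ≤ (∑ j, ‖f j‖ ^ 2) ^ 2 := by
  have hsq : ∑ x : (∀ v, ι v) × (∀ v, ι v), ‖f x.1 * f x.2‖ ^ 2 = (∑ j, ‖f j‖ ^ 2) ^ 2 := by
    rw [Fintype.sum_prod_type, sq (∑ j, ‖f j‖ ^ 2), Finset.sum_mul_sum]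
    simp_rw [norm_mul, mul_pow]
  have hsq' := (mixPair S).sum_comp fun x : (∀ v, ι v) × (∀ v, ι v) => ‖f x.1 * f x.2‖ ^ 2
  calc _ ≤ ∑ x : (∀ v, ι v) × (∀ v, ι v), (‖f x.1 * f x.2‖ ^ 2 / 2 +
        ‖f (mixPair S x).1 * f (mixPair S x).2‖ ^ 2 / 2) := by
        refine (norm_sum_le _ _).trans (Finset.sum_le_sum fun x _ => ?_)
        rw [norm_mul, norm_star]
        nlinarith [sq_nonneg (‖f x.1 * f x.2‖ - ‖f (mixPair S x).1 * f (mixPair S x).2‖)]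
    _ = _ := by
        rw [Finset.sum_add_distrib, ← Finset.sum_div, ← Finset.sum_div, hsq', hsq]; ring

/-- By independence the moment factorises over the vertices; each vertex in `S` contributes the
identity pairing, each vertex outside `S` the swap. -/
theorem integral_productAmplitude_four (r : ∀ v, ι v → ℂ)
    (hr : ∀ v, ∑ i, r v i * star (r v i) = 1) (f : (∀ v, ι v) → ℂ) :
    ∫ U, productAmplitude r f U * star (productAmplitude r f U) *
        (productAmplitude r f U * star (productAmplitude r f U))
        ∂(Measure.pi fun v => haarUnitary (ι v)) =
      (∏ v, ((1 : ℂ) / (Fintype.card (ι v) * (Fintype.card (ι v) + 1)))) *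
        ∑ S : Finset V, ∑ x : (∀ v, ι v) × (∀ v, ι v), f x.1 * f x.2 *
          star (f (mixPair S x).1 * f (mixPair S x).2) := by
  have hexp : ∀ U, productAmplitude r f U * star (productAmplitude r f U) *
        (productAmplitude r f U * star (productAmplitude r f U)) =
      ∑ x : (∀ v, ι v) × (∀ v, ι v), ∑ y : (∀ v, ι v) × (∀ v, ι v),
        f x.1 * f x.2 * star (f y.1 * f y.2) *
        ∏ v, (unitaryVec (r v) (U v) (x.1 v) * star (unitaryVec (r v) (U v) (y.1 v)) *
          (unitaryVec (r v) (U v) (x.2 v) * star (unitaryVec (r v) (U v) (y.2 v)))) := by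
    intro U
    have h2 : productAmplitude r f U * productAmplitude r f U =
        ∑ x : (∀ v, ι v) × (∀ v, ι v), f x.1 * f x.2 *
          ∏ v, (unitaryVec (r v) (U v) (x.1 v) * unitaryVec (r v) (U v) (x.2 v)) := by
      rw [productAmplitude, Finset.sum_mul_sum, Fintype.sum_prod_type]
      refine Finset.sum_congr rfl fun i _ => Finset.sum_congr rfl fun j _ => ?_
      rw [Finset.prod_mul_distrib]; ring
    rw [mul_mul_mul_comm, ← star_mul', h2, star_sum, Finset.sum_mul_sum]
    refine Finset.sum_congr rfl fun x _ => Finset.sum_congr rfl fun y _ => ?_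
    simp only [star_mul', star_prod, Finset.prod_mul_distrib]
    ring
  simp_rw [hexp]
  have hint := fun x y : (∀ v, ι v) × (∀ v, ι v) => (integrable_prod_haarUnitary
    (fun v => continuous_moment4 (r v) (x.1 v) (y.1 v) (x.2 v) (y.2 v))).const_mul
      (f x.1 * f x.2 * star (f y.1 * f y.2))
  rw [integral_finsetSum _ fun x _ => integrable_finsetSum _ fun y _ => hint x y,
    Finset.sum_comm (s := (Finset.univ : Finset (Finset V))), Finset.mul_sum]
  refine Finset.sum_congr rfl fun x _ => ?_
  rw [integral_finsetSum _ fun y _ => hint x y]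
  have hprod : ∀ y : (∀ v, ι v) × (∀ v, ι v),
      ∫ U : ∀ v, Matrix.unitaryGroup (ι v) ℂ, f x.1 * f x.2 * star (f y.1 * f y.2) *
        ∏ v, (unitaryVec (r v) (U v) (x.1 v) * star (unitaryVec (r v) (U v) (y.1 v)) *
          (unitaryVec (r v) (U v) (x.2 v) * star (unitaryVec (r v) (U v) (y.2 v))))
        ∂(Measure.pi fun v => haarUnitary (ι v)) =
      ∑ S : Finset V, (if y = mixPair S x then f x.1 * f x.2 * star (f y.1 * f y.2) else 0) *
        ∏ v, ((1 : ℂ) / (Fintype.card (ι v) * (Fintype.card (ι v) + 1))) := by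
    intro y
    rw [integral_const_mul, integral_fintype_prod_eq_prod (fun v U =>
      unitaryVec (r v) U (x.1 v) * star (unitaryVec (r v) U (y.1 v)) *
          (unitaryVec (r v) U (x.2 v) * star (unitaryVec (r v) U (y.2 v))))]
    change _ * ∏ v, haarMoment4 (r v) (x.1 v) (y.1 v) (x.2 v) (y.2 v) = _
    -- `Finset.prod_add` expands the product of the sums identity plus swap into a sum over the set
    -- `S` of vertices where the identity is chosen.
    rw [Finset.prod_congr rfl fun v _ => haarMoment4_eq (r v) (hr v) (x.1 v) (y.1 v) (x.2 v) (y.2 v),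
      Finset.prod_mul_distrib, Finset.prod_add, ← Finset.sum_mul, ← mul_assoc,
      Finset.mul_sum, Finset.powerset_univ]
    congr 1
    refine Finset.sum_congr rfl fun S _ => ?_
    rw [Finset.prod_ite_zero, Finset.prod_ite_zero]
    have hiff : ((∀ v ∈ S, x.1 v = y.1 v ∧ x.2 v = y.2 v) ∧
        ∀ v ∈ Finset.univ \ S, x.1 v = y.2 v ∧ y.1 v = x.2 v) ↔ y = mixPair S x := by
      simp only [Prod.ext_iff, funext_iff, mixPair, Equiv.coe_fn_mk, Finset.piecewise]
      constructor
      · rintro ⟨h1, h2⟩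
        refine ⟨fun v => ?_, fun v => ?_⟩ <;> by_cases hv : v ∈ S <;> simp [hv]
        · exact (h1 v hv).1.symm
        · exact (h2 v (by simp [hv])).2
        · exact (h1 v hv).2.symm
        · exact (h2 v (by simp [hv])).1.symm
      · rintro ⟨h1, h2⟩
        refine ⟨fun v hv => ?_, fun v hv => ?_⟩
        · have := h1 v; have := h2 v; simp_all
        · have := h1 v; have := h2 v; simp_all
    by_cases hy : y = mixPair S x
    · obtain ⟨h1, h2⟩ := hiff.mpr hy
      rw [if_pos h1, if_pos h2, if_pos hy]; simp
    · rw [if_neg hy]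
      rw [← hiff, not_and_or] at hy
      rcases hy with h | h <;> rw [if_neg h] <;> simp
  simp_rw [hprod]
  rw [Finset.sum_comm, Finset.mul_sum]
  refine Finset.sum_congr rfl fun S _ => ?_
  rw [← Finset.sum_mul, Finset.sum_ite_eq' Finset.univ, if_pos (Finset.mem_univ _), mul_comm]

theorem integral_norm_productAmplitude_sq (r : ∀ v, ι v → ℂ)
    (hr : ∀ v, ∑ i, r v i * star (r v i) = 1) (f : (∀ v, ι v) → ℂ) :
    ∫ U, ‖productAmplitude r f U‖ ^ 2 ∂(Measure.pi fun v => haarUnitary (ι v)) =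
      (∑ j, ‖f j‖ ^ 2) * ∏ v, ((1 : ℝ) / Fintype.card (ι v)) := by
  have h := integral_productAmplitude_two r hr f
  have hn : ∀ z : ℂ, z * star z = ((‖z‖ ^ 2 : ℝ) : ℂ) := fun z => by
    rw [Complex.star_def, Complex.mul_conj, Complex.normSq_eq_norm_sq]
  simp_rw [hn] at h
  rw [integral_complex_ofReal] at h
  refine Complex.ofReal_injective (h.trans ?_)
  push_cast
  rfl

theorem integral_norm_productAmplitude_pow_four_le (r : ∀ v, ι v → ℂ)
    (hr : ∀ v, ∑ i, r v i * star (r v i) = 1) (f : (∀ v, ι v) → ℂ) :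
    ∫ U, ‖productAmplitude r f U‖ ^ 4 ∂(Measure.pi fun v => haarUnitary (ι v)) ≤
      (∏ v, ((1 : ℝ) / (Fintype.card (ι v) * (Fintype.card (ι v) + 1)))) *
        (2 ^ Fintype.card V * (∑ j, ‖f j‖ ^ 2) ^ 2) := by
  have h := integral_productAmplitude_four r hr f
  have hn : ∀ z : ℂ, z * star z * (z * star z) = ((‖z‖ ^ 4 : ℝ) : ℂ) := fun z => by
    rw [Complex.star_def, Complex.mul_conj, Complex.normSq_eq_norm_sq]
    push_cast; ring
  simp_rw [hn] at h
  rw [integral_complex_ofReal] at h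
  have h' := congrArg norm h
  rw [Complex.norm_real, Real.norm_eq_abs, norm_mul, norm_prod] at h'
  refine (le_abs_self _).trans (h'.le.trans ?_)
  have hp : ∀ v : V, ‖(1 : ℂ) / (Fintype.card (ι v) * (Fintype.card (ι v) + 1))‖ =
      (1 : ℝ) / (Fintype.card (ι v) * (Fintype.card (ι v) + 1)) := fun v => by
    rw [show (1 : ℂ) / (Fintype.card (ι v) * (Fintype.card (ι v) + 1)) =
      (((1 : ℝ) / (Fintype.card (ι v) * (Fintype.card (ι v) + 1)) : ℝ) : ℂ) by push_cast; rfl,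
      Complex.norm_real, Real.norm_of_nonneg (by positivity)]
  simp_rw [hp]
  refine mul_le_mul_of_nonneg_left ?_ (Finset.prod_nonneg fun v _ => by positivity)
  refine (norm_sum_le _ _).trans
    ((Finset.sum_le_sum fun S _ => norm_sum_mixPair_le f S).trans (le_of_eq ?_))
  simp

end ProductMoments

/-! ## The inverse effective dimension of a random tensor network -/

/-- A contraction involves only those families of local labels that agree at both ends of each edge.
Extending its coefficients by zero makes it a functional on all families without changing the norm.
-/
theorem sum_norm_sq_extend {A B : Type*} [Fintype A] [Fintype B] {e : A → B}
    (he : Function.Injective e) (g : A → ℂ) :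
    ∑ j, ‖Function.extend e g 0 j‖ ^ 2 = ∑ i, ‖g i‖ ^ 2 :=
  (Fintype.sum_of_injective e he _ _
    (fun j hj => by rw [Function.extend_apply' _ _ _ hj]; simp)
    (fun i => by rw [he.extend_apply])).symm

theorem productAmplitude_extend {V A : Type} [Fintype V] [DecidableEq V] [Fintype A]
    {ι : V → Type} [∀ v, Fintype (ι v)] [∀ v, DecidableEq (ι v)] (r : ∀ v, ι v → ℂ)
    {e : A → ∀ v, ι v} (he : Function.Injective e) (g : A → ℂ)
    (U : ∀ v, Matrix.unitaryGroup (ι v) ℂ) :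
    productAmplitude r (Function.extend e g 0) U =
      ∑ i, g i * ∏ v, unitaryVec (r v) (U v) (e i v) :=
  (Fintype.sum_of_injective e he _ _
    (fun j hj => by rw [Function.extend_apply' _ _ _ hj]; simp)
    (fun i => by rw [he.extend_apply])).symm

theorem EuclideanSpace.sum_mul_star_eq_one {ι : Type} [Fintype ι] {r : EuclideanSpace ℂ ι}
    (hr : ‖r‖ = 1) : ∑ i, r i * star (r i) = 1 := by
  have h := EuclideanSpace.norm_sq_eq r
  rw [hr] at h
  have h' : ∀ z : ℂ, z * star z = ((‖z‖ ^ 2 : ℝ) : ℂ) := fun z => by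
    rw [Complex.star_def, Complex.mul_conj, Complex.normSq_eq_norm_sq]
  simp_rw [h', ← Complex.ofReal_sum, ← h]
  simp

section Network

variable {V X : Type} (G : SimpleGraph V) (site : X → V) (a b d : ℕ)

/-- The basis labels at the vertices induced by labels of the sites, the internal edges and the
logical legs. -/
def legLabel (x : (X → Fin a) × (G.edgeSet → Fin b) × (V → Fin d)) (v : V) :
    LegIndex G site a b d v :=
  (fun y => x.1 y.1, fun e => x.2.1 ⟨e.1, e.2.1⟩, x.2.2 v)

/-- Every site, edge and logical leg is attached to some vertex, where its label can be read off. -/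
theorem legLabel_injective : Function.Injective (legLabel G site a b d) := by
  rintro ⟨s, k, l⟩ ⟨s', k', l'⟩ h
  have h1 : s = s' := funext fun y =>
    congrFun (congrArg Prod.fst (congrFun h (site y))) ⟨y, rfl⟩
  have h2 : k = k' := by
    funext e
    obtain ⟨e, he⟩ := e
    obtain ⟨v, hv⟩ : ∃ v, v ∈ e := by
      induction e with
      | _ u w => exact ⟨u, Sym2.mem_mk_left u w⟩
    exact congrFun (congrArg (fun z => z.2.1) (congrFun h v)) ⟨e, he, hv⟩
  have h3 : l = l' := funext fun v => congrArg (fun z => z.2.2) (congrFun h v)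
  rw [h1, h2, h3]

variable [Fintype V] [Fintype X]

-- Each boundary configuration is a separate amplitude with coefficients `star (Φ l)`, repeated for
-- all bond labels; its squared coefficient norm is `b^E`, and there are `a^n` configurations.
open Classical in
theorem integral_norm_rtnState_sq (ref : (v : V) → EuclideanSpace ℂ (LegIndex G site a b d v))
    (Φ : EuclideanSpace ℂ (V → Fin d)) (href : ∀ v, ‖ref v‖ = 1) (hΦ : ‖Φ‖ = 1) :
    ∫ U, ‖rtnState G site a b d ref Φ U‖ ^ 2 ∂(rtnMeasure G site a b d) =
      (a : ℝ) ^ Fintype.card X * (b : ℝ) ^ Fintype.card G.edgeSet *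
        ∏ v, ((1 : ℝ) / Fintype.card (LegIndex G site a b d v)) := by
  have hinj : ∀ s, Function.Injective fun x : (G.edgeSet → Fin b) × (V → Fin d) =>
      legLabel G site a b d (s, x) := fun s =>
    (legLabel_injective G site a b d).comp fun x y h => (Prod.ext_iff.mp h).2
  have hamp : ∀ U s, rtnState G site a b d ref Φ U s = productAmplitude (fun v => ref v)
      (Function.extend (fun x => legLabel G site a b d (s, x)) (fun x => star (Φ x.2)) 0) U := by
    intro U s
    rw [productAmplitude_extend _ (hinj s), Fintype.sum_prod_type]
    rfl
  have hnorm : ∀ U, ‖rtnState G site a b d ref Φ U‖ ^ 2 = ∑ s, ‖productAmplitude (fun v => ref v)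
      (Function.extend (fun x => legLabel G site a b d (s, x)) (fun x => star (Φ x.2)) 0) U‖ ^ 2 :=
    fun U => by simp_rw [EuclideanSpace.norm_sq_eq, hamp]
  simp_rw [hnorm, rtnMeasure]
  rw [integral_finsetSum _ fun s _ => ?_]
  · rw [Finset.sum_congr rfl fun s _ => integral_norm_productAmplitude_sq (fun v => ref v)
      (fun v => EuclideanSpace.sum_mul_star_eq_one (href v)) _]
    simp_rw [sum_norm_sq_extend (hinj _), Fintype.sum_prod_type, norm_star,
      ← EuclideanSpace.norm_sq_eq, hΦ]
    simp [mul_assoc]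
  · exact integrable_norm_productAmplitude_sq _ _

-- The coefficients are those of `φ ⊗ Φ`, repeated for all bond labels. As `φ` is a unit vector
-- their squared norm is `b^E` with no power of `a`; this is the source of the decay in `n`.
open Classical in
theorem integral_norm_inner_rtnState_le
    (ref : (v : V) → EuclideanSpace ℂ (LegIndex G site a b d v))
    (Φ : EuclideanSpace ℂ (V → Fin d)) (φ : EuclideanSpace ℂ (X → Fin a))
    (h : AreUnitVectors G site a b d ref Φ φ) :
    ∫ U, ‖inner ℂ (rtnState G site a b d ref Φ U) φ‖ ^ 4 ∂(rtnMeasure G site a b d) ≤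
      (∏ v, ((1 : ℝ) / (Fintype.card (LegIndex G site a b d v) *
        (Fintype.card (LegIndex G site a b d v) + 1)))) *
        (2 ^ Fintype.card V * ((b : ℝ) ^ Fintype.card G.edgeSet) ^ 2) := by
  obtain ⟨href, hΦ, hφ⟩ := h
  have hinj := legLabel_injective G site a b d
  have hamp : ∀ U, ‖inner ℂ (rtnState G site a b d ref Φ U) φ‖ = ‖productAmplitude (fun v => ref v)
      (Function.extend (legLabel G site a b d) (fun x => star (φ x.1) * star (Φ x.2.2)) 0) U‖ := by
    intro U
    rw [productAmplitude_extend _ hinj, Fintype.sum_prod_type, norm_inner_symm, PiLp.inner_apply]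
    congr 1
    refine Finset.sum_congr rfl fun s _ => ?_
    rw [RCLike.inner_apply', Fintype.sum_prod_type]
    simp_rw [mul_assoc, ← Finset.mul_sum]
    rfl
  simp_rw [hamp, rtnMeasure]
  refine (integral_norm_productAmplitude_pow_four_le (fun v => ref v)
    (fun v => EuclideanSpace.sum_mul_star_eq_one (href v)) _).trans (le_of_eq ?_)
  rw [sum_norm_sq_extend hinj]
  simp_rw [Fintype.sum_prod_type, norm_mul, mul_pow, norm_star, ← Finset.mul_sum,
    ← EuclideanSpace.norm_sq_eq, hΦ]
  have hφ' := EuclideanSpace.norm_sq_eq φ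
  rw [hφ] at hφ'
  rw [← Finset.sum_mul, ← hφ']
  simp

/-- Up to `1 / (D (D + 1)) ≤ 1 / D²` at each vertex, numerator and denominator share all factors
except `2^|V|` and `a^n`. -/
theorem invEffDim_le (ha : 1 ≤ a) (hb : 1 ≤ b) (hd : 1 ≤ d)
    (ref : (v : V) → EuclideanSpace ℂ (LegIndex G site a b d v))
    (Φ : EuclideanSpace ℂ (V → Fin d)) (φ : EuclideanSpace ℂ (X → Fin a))
    (h : AreUnitVectors G site a b d ref Φ φ) :
    invEffDim G site a b d ref Φ φ ≤ 2 ^ Fintype.card V / (a : ℝ) ^ Fintype.card X := by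
  classical
  have hF := integral_norm_inner_rtnState_le G site a b d ref Φ φ h
  have hS := integral_norm_rtnState_sq G site a b d ref Φ h.1 h.2.1
  unfold invEffDim
  rw [hS]
  have : Nonempty (Fin a) := ⟨⟨0, ha⟩⟩
  have : Nonempty (Fin b) := ⟨⟨0, hb⟩⟩
  have : Nonempty (Fin d) := ⟨⟨0, hd⟩⟩
  have hD : ∀ v, (0 : ℝ) < Fintype.card (LegIndex G site a b d v) := fun v => by
    exact_mod_cast Fintype.card_pos
  have ha' : (0 : ℝ) < (a : ℝ) ^ Fintype.card X := by positivity
  have hb' : (0 : ℝ) < (b : ℝ) ^ Fintype.card G.edgeSet := by positivity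
  have hP : 0 < ∏ v, ((1 : ℝ) / Fintype.card (LegIndex G site a b d v)) :=
    Finset.prod_pos fun v _ => one_div_pos.mpr (hD v)
  have hQ : ∏ v, ((1 : ℝ) / (Fintype.card (LegIndex G site a b d v) *
        (Fintype.card (LegIndex G site a b d v) + 1))) ≤
      (∏ v, ((1 : ℝ) / Fintype.card (LegIndex G site a b d v))) ^ 2 := by
    rw [← Finset.prod_pow]
    refine Finset.prod_le_prod (fun v _ => ?_) fun v _ => ?_
    · have := hD v; positivity
    · have := hD v
      rw [div_pow, one_pow]
      exact one_div_le_one_div_of_le (by positivity) (by nlinarith)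
  generalize ∏ v, ((1 : ℝ) / Fintype.card (LegIndex G site a b d v)) = P at *
  generalize ∏ v, ((1 : ℝ) / (Fintype.card (LegIndex G site a b d v) *
        (Fintype.card (LegIndex G site a b d v) + 1))) = Q at *
  generalize (a : ℝ) ^ Fintype.card X = A at *
  generalize (b : ℝ) ^ Fintype.card G.edgeSet = B at *
  rw [div_le_div_iff₀ (by positivity) ha']
  calc _ ≤ A * (P ^ 2 * (2 ^ Fintype.card V * B ^ 2)) * A := by
        gcongr
        exact hF.trans (by gcongr)
    _ = _ := by ring

end Network

/-! ## Flux through hyperbolic segments -/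

section Flux

open UpperHalfPlane ComplexConjugate

open scoped MatrixGroups

/-- Half of the flux of the unit horocyclic field centred at `∞` through the geodesic segment from
`u` to `v`. -/
def halfFlux (u v : ℍ) : ℝ := Complex.arg (-Complex.I * (u - conj (v : ℂ)))

theorem halfFlux_arg_re (u v : ℍ) : (-Complex.I * ((u : ℂ) - conj (v : ℂ))).re = u.im + v.im := by
  simp

theorem halfFlux_arg_ne_zero (u v : ℍ) : -Complex.I * ((u : ℂ) - conj (v : ℂ)) ≠ 0 := by
  intro h
  have h' := congrArg Complex.re h
  rw [halfFlux_arg_re] at h'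
  have := u.im_pos
  have := v.im_pos
  simp at h'
  linarith

theorem abs_halfFlux_lt (u v : ℍ) : |halfFlux u v| < Real.pi / 2 := by
  rw [halfFlux, Complex.abs_arg_lt_pi_div_two_iff, halfFlux_arg_re]
  exact Or.inl (add_pos u.im_pos v.im_pos)

theorem halfFlux_swap (u v : ℍ) : halfFlux v u = -halfFlux u v := by
  have h : -Complex.I * ((v : ℂ) - conj (u : ℂ)) = conj (-Complex.I * ((u : ℂ) - conj (v : ℂ))) := by
    simp only [map_mul, map_sub, map_neg, Complex.conj_I, Complex.conj_conj]; ring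
  rw [halfFlux, h, Complex.arg_conj, if_neg, halfFlux]
  intro h'
  have := abs_halfFlux_lt u v
  rw [halfFlux, h', abs_of_pos Real.pi_pos] at this
  linarith [Real.pi_pos]

/-- The cosine is `(Im u + Im v) / |u - conj v|`, and `cosh (dist u v / 2)` is `|u - conj v| / (2
√(Im u Im v))`; compare by the arithmetic–geometric mean inequality. This bounds the flux by length
alone. -/
theorem inv_cosh_le_cos_halfFlux (u v : ℍ) :
    (Real.cosh (dist u v / 2))⁻¹ ≤ Real.cos (halfFlux u v) := by
  have hn : ‖-Complex.I * ((u : ℂ) - conj (v : ℂ))‖ = dist (u : ℂ) (conj (v : ℂ)) := by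
    rw [norm_mul, norm_neg, Complex.norm_I, one_mul, dist_eq_norm]
  have hpos := norm_pos_iff.mpr (halfFlux_arg_ne_zero u v)
  rw [hn] at hpos
  rw [halfFlux, Complex.cos_arg (halfFlux_arg_ne_zero u v), halfFlux_arg_re, hn,
    UpperHalfPlane.cosh_half_dist, inv_div]
  gcongr
  have hu := u.im_pos
  have hv := v.im_pos
  rw [Real.sqrt_mul hu.le]
  nlinarith [sq_nonneg (√u.im - √v.im), Real.sq_sqrt hu.le, Real.sq_sqrt hv.le]

/-- Moving the segment amounts to moving the centre of the horocyclic field. This changes the flux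
by a difference of endpoint terms, the arguments of the automorphy factor `c z + d`, which cancel
around closed polygons. -/
theorem halfFlux_smul (g : SL(2, ℝ)) (u v : ℍ) :
    halfFlux (g • u) (g • v) = halfFlux u v - Complex.arg (g 1 0 * u + g 1 1) +
      Complex.arg (g 1 0 * v + g 1 1) := by
  have hdet : (g 0 0 : ℂ) * g 1 1 - g 0 1 * g 1 0 = 1 := by
    have := g.det_coe
    rw [Matrix.det_fin_two] at this
    exact_mod_cast this
  have hJ : ∀ z : ℍ, (g 1 0 : ℂ) * z + g 1 1 ≠ 0 := fun z => UpperHalfPlane.denom_ne_zero g z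
  have hJ' : conj ((g 1 0 : ℂ) * (v : ℂ) + g 1 1) ≠ 0 := (map_ne_zero conj).mpr (hJ v)
  have hfrac : -Complex.I * (((g • u : ℍ) : ℂ) - conj ((g • v : ℍ) : ℂ)) =
      -Complex.I * ((u : ℂ) - conj (v : ℂ)) /
        (((g 1 0 : ℂ) * (u : ℂ) + g 1 1) * conj ((g 1 0 : ℂ) * (v : ℂ) + g 1 1)) := by
    have hu := hJ u
    rw [UpperHalfPlane.coe_specialLinearGroup_apply, UpperHalfPlane.coe_specialLinearGroup_apply]
    simp only [map_div₀, map_add, map_mul, Complex.conj_ofReal, Algebra.algebraMap_self,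
      RingHom.id_apply] at hJ' ⊢
    rw [div_sub_div _ _ hu hJ', ← mul_div_assoc]
    congr 1
    linear_combination (-Complex.I * ((u : ℂ) - conj (v : ℂ))) * hdet
  have hangle : ((halfFlux (g • u) (g • v) : ℝ) : Real.Angle) =
      ((halfFlux u v - Complex.arg (g 1 0 * u + g 1 1) + Complex.arg (g 1 0 * v + g 1 1) : ℝ) :
        Real.Angle) := by
    rw [halfFlux, hfrac, Complex.arg_div_coe_angle (halfFlux_arg_ne_zero u v)
      (mul_ne_zero (hJ u) hJ'), Complex.arg_mul_coe_angle (hJ u) hJ', Complex.arg_conj_coe_angle,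
      Real.Angle.coe_add, Real.Angle.coe_sub, halfFlux]
    abel
  obtain ⟨k, hk⟩ := Real.Angle.angle_eq_iff_two_pi_dvd_sub.mp hangle
  -- The identity holds modulo `2π`. Both automorphy factors lie in the same closed half-plane,
  -- according to the sign of `c`, so the discrepancy is below `2π` and vanishes.
  have harg : |Complex.arg (g 1 0 * u + g 1 1) - Complex.arg (g 1 0 * v + g 1 1)| ≤ Real.pi := by
    have him : ∀ z : ℍ, ((g 1 0 : ℂ) * z + g 1 1).im = g 1 0 * z.im := fun z => by simp
    rw [abs_le]
    have h1 := fun z : ℍ => Complex.arg_le_pi ((g 1 0 : ℂ) * z + g 1 1)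
    have h2 := fun z : ℍ => Complex.neg_pi_lt_arg ((g 1 0 : ℂ) * z + g 1 1)
    rcases le_or_gt 0 (g 1 0) with hc | hc
    · have h0 : ∀ z : ℍ, 0 ≤ Complex.arg ((g 1 0 : ℂ) * z + g 1 1) := fun z => by
        rw [Complex.arg_nonneg_iff, him]; exact mul_nonneg hc z.im_pos.le
      constructor <;> linarith [h1 u, h1 v, h0 u, h0 v]
    · have h0 : ∀ z : ℍ, Complex.arg ((g 1 0 : ℂ) * z + g 1 1) < 0 := fun z => by
        rw [Complex.arg_neg_iff, him]; exact mul_neg_of_neg_of_pos hc z.im_pos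
      constructor <;> linarith [h2 u, h2 v, h0 u, h0 v]
  have hk0 : k = 0 := by
    have h1 := abs_lt.mp (abs_halfFlux_lt (g • u) (g • v))
    have h2 := abs_lt.mp (abs_halfFlux_lt u v)
    have h3 := abs_le.mp harg
    have hpi := Real.pi_pos
    have hlt : (k : ℝ) < 1 := by nlinarith
    have hgt : (-1 : ℝ) < k := by nlinarith
    have : k < 1 := by exact_mod_cast hlt
    have : -1 < k := by exact_mod_cast hgt
    omega
  rw [hk0] at hk
  simpa [sub_eq_zero] using hk

/-- Half of the flux out of the triangle `u v w`. -/
def triangleHalfFlux (u v w : ℍ) : ℝ := halfFlux u v + halfFlux v w + halfFlux w u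

theorem triangleHalfFlux_smul (g : SL(2, ℝ)) (u v w : ℍ) :
    triangleHalfFlux (g • u) (g • v) (g • w) = triangleHalfFlux u v w := by
  simp only [triangleHalfFlux, halfFlux_smul]; ring

/-- The rotation by the angle `2 θ` about the point `i l`. -/
def rotationAt (l θ : ℝ) (hl : l ≠ 0) : SL(2, ℝ) :=
  ⟨!![Real.cos θ, l * Real.sin θ; -l⁻¹ * Real.sin θ, Real.cos θ], by
    rw [Matrix.det_fin_two_of]
    field_simp
    linear_combination Real.cos_sq_add_sin_sq θ⟩

theorem coe_rotationAt (l θ : ℝ) (hl : l ≠ 0) :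
    (rotationAt l θ hl : Matrix (Fin 2) (Fin 2) ℝ) =
      !![Real.cos θ, l * Real.sin θ; -l⁻¹ * Real.sin θ, Real.cos θ] := rfl

theorem rotationAt_mul (l θ φ : ℝ) (hl : l ≠ 0) :
    rotationAt l θ hl * rotationAt l φ hl = rotationAt l (θ + φ) hl := by
  apply Subtype.ext
  rw [Matrix.SpecialLinearGroup.coe_mul, coe_rotationAt, coe_rotationAt, coe_rotationAt,
    Matrix.mul_fin_two, Real.cos_add, Real.sin_add]
  ext i j
  fin_cases i <;> fin_cases j <;> simp <;> field_simp <;> ring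

theorem rotationAt_pow (l θ : ℝ) (hl : l ≠ 0) (n : ℕ) :
    rotationAt l θ hl ^ n = rotationAt l (n * θ) hl := by
  induction n with
  | zero =>
    apply Subtype.ext
    simp [coe_rotationAt, Matrix.one_fin_two]
  | succ n ih => rw [pow_succ, ih, rotationAt_mul]; congr 1; push_cast; ring

theorem rotationAt_pi (l : ℝ) (hl : l ≠ 0) : rotationAt l Real.pi hl = -1 := by
  apply Subtype.ext
  simp [coe_rotationAt, Matrix.one_fin_two]

/-- Cayley–Hamilton with trace `0` and determinant `1`: such a matrix acts as a half-turn. -/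
theorem specialLinearGroup_sq_eq_neg_one (g : SL(2, ℝ)) (h : g 0 0 + g 1 1 = 0) : g ^ 2 = -1 := by
  have hdet := g.det_coe
  rw [Matrix.det_fin_two] at hdet
  ext i j
  fin_cases i <;> fin_cases j <;>
    simp [sq, Matrix.mul_apply, Fin.sum_univ_two]
  · linear_combination g 0 0 * h - hdet
  · linear_combination g 0 1 * h
  · linear_combination g 1 0 * h
  · linear_combination g 1 1 * h - hdet

/-- The point `i l` of the upper half-plane. -/
def imagPoint (l : ℝ) (hl : 0 < l) : ℍ := ⟨⟨0, l⟩, hl⟩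

theorem coe_imagPoint (l : ℝ) (hl : 0 < l) : (imagPoint l hl : ℂ) = l * Complex.I := by
  apply Complex.ext <;> simp [imagPoint]

theorem coe_rotationAt_smul (l θ : ℝ) (hl : l ≠ 0) (z : ℍ) :
    ((rotationAt l θ hl • z : ℍ) : ℂ) = (Real.cos θ * z + l * Real.sin θ) /
      (-(l : ℂ)⁻¹ * Real.sin θ * z + Real.cos θ) := by
  rw [UpperHalfPlane.coe_specialLinearGroup_apply]
  simp [rotationAt]

theorem rotationAt_smul_imagPoint (l θ : ℝ) (hl : 0 < l) :
    rotationAt l θ hl.ne' • imagPoint l hl = imagPoint l hl := by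
  apply UpperHalfPlane.ext
  have h := UpperHalfPlane.denom_ne_zero (rotationAt l θ hl.ne' : SL(2, ℝ)) (imagPoint l hl)
  have h' : (-(l : ℂ)⁻¹ * Real.sin θ * imagPoint l hl + Real.cos θ) ≠ 0 := by
    rw [UpperHalfPlane.denom] at h
    simpa [coe_rotationAt] using h
  rw [coe_rotationAt_smul, div_eq_iff h', coe_imagPoint]
  have : (l : ℂ) ≠ 0 := by exact_mod_cast hl.ne'
  field_simp
  linear_combination (Real.sin θ : ℂ) * Complex.I_sq

end Flux

/-! ## The regular polygon with angles `2 β` and central angles `2 α` -/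

section Polygon

open UpperHalfPlane ComplexConjugate

open scoped MatrixGroups

/-- `i l` is a vertex of the regular polygon centred at `i` with angles `2 β` and central
angles `2 α`. -/
structure IsPolygonVertex (α β l : ℝ) : Prop where
  pos_left : 0 < α
  pos_right : 0 < β
  add_lt : α + β < Real.pi / 2
  one_lt : 1 < l
  sin_mul_sin : Real.sin α * Real.sin β * (l ^ 2 + 1) = 2 * l * Real.cos α * Real.cos β

/-- With circumradius `log l` the condition reads `cosh (log l) = C`, where `C = cot α cot β`. Here
`C > 1` because `cos (α + β) > 0`, and `l` is the larger root of `l² - 2 C l + 1`. -/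
theorem exists_isPolygonVertex {α β : ℝ} (hα : 0 < α) (hβ : 0 < β) (h : α + β < Real.pi / 2) :
    ∃ l, IsPolygonVertex α β l := by
  have hsα : 0 < Real.sin α := Real.sin_pos_of_pos_of_lt_pi hα (by linarith)
  have hsβ : 0 < Real.sin β := Real.sin_pos_of_pos_of_lt_pi hβ (by linarith)
  have hcos : 0 < Real.cos (α + β) := Real.cos_pos_of_mem_Ioo ⟨by linarith, h⟩
  rw [Real.cos_add] at hcos
  obtain ⟨C, hC⟩ : ∃ C, C = Real.cos α * Real.cos β / (Real.sin α * Real.sin β) := ⟨_, rfl⟩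
  have hC1 : 1 < C := by rw [hC, one_lt_div (by positivity)]; linarith
  have hC' : Real.cos α * Real.cos β = C * (Real.sin α * Real.sin β) := by
    rw [hC]; field_simp
  have hsq : √(C ^ 2 - 1) ^ 2 = C ^ 2 - 1 := Real.sq_sqrt (by nlinarith)
  refine ⟨C + √(C ^ 2 - 1), hα, hβ, h, by linarith [Real.sqrt_nonneg (C ^ 2 - 1)], ?_⟩
  linear_combination Real.sin α * Real.sin β * hsq - 2 * (C + √(C ^ 2 - 1)) * hC'

namespace IsPolygonVertex

variable {α β l : ℝ} (h : IsPolygonVertex α β l)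

include h

theorem pos : 0 < l := zero_lt_one.trans h.one_lt

theorem sin_right_pos : 0 < Real.sin β :=
  Real.sin_pos_of_pos_of_lt_pi h.pos_right (by linarith [h.add_lt, h.pos_right, h.pos_left])

theorem cos_left_pos : 0 < Real.cos α :=
  Real.cos_pos_of_mem_Ioo ⟨by linarith [h.add_lt, h.pos_right, h.pos_left],
    by linarith [h.add_lt, h.pos_right]⟩

theorem normSq_pos : 0 < Real.cos α ^ 2 + l ^ 2 * Real.sin α ^ 2 := by
  have := h.cos_left_pos
  positivity

theorem denom_ne_zero : (Real.cos α : ℂ) - l * Real.sin α * Complex.I ≠ 0 := by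
  intro h0
  have := congrArg Complex.re h0
  simp [-Complex.ofReal_cos, -Complex.ofReal_sin] at this
  exact h.cos_left_pos.ne' this

theorem conj_denom_ne_zero : (Real.cos α : ℂ) + l * Real.sin α * Complex.I ≠ 0 := by
  intro h0
  have := congrArg Complex.re h0
  simp [-Complex.ofReal_cos, -Complex.ofReal_sin] at this
  exact h.cos_left_pos.ne' this

theorem coe_next : ((rotationAt 1 α one_ne_zero • imagPoint l h.pos : ℍ) : ℂ) =
    (Real.sin α + l * Real.cos α * Complex.I) / (Real.cos α - l * Real.sin α * Complex.I) := by
  rw [coe_rotationAt_smul, coe_imagPoint]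
  congr 1 <;> push_cast <;> ring

theorem im_next : (rotationAt 1 α one_ne_zero • imagPoint l h.pos).im =
    l / (Real.cos α ^ 2 + l ^ 2 * Real.sin α ^ 2) := by
  rw [← UpperHalfPlane.coe_im, h.coe_next, Complex.div_im, Complex.normSq_apply]
  have h1 := h.normSq_pos
  simp [-Complex.ofReal_cos, -Complex.ofReal_sin]
  have h2 : Real.cos α * Real.cos α + l * Real.sin α * (l * Real.sin α) =
    Real.cos α ^ 2 + l ^ 2 * Real.sin α ^ 2 := by ring
  rw [h2]
  field_simp
  linear_combination l * Real.cos_sq_add_sin_sq α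

/-- The vertex equation turns the number whose argument is the half flux through a side into an
explicit modulus and phase. The phase yields the area, the modulus the side length. -/
theorem edge_arg : -Complex.I * ((imagPoint l h.pos : ℂ) -
      conj ((rotationAt 1 α one_ne_zero • imagPoint l h.pos : ℍ) : ℂ)) =
    (2 * l * Real.cos α / Real.sin β : ℝ) * (Real.sin β + Real.cos β * Complex.I) /
      (Real.cos α + l * Real.sin α * Complex.I) := by
  have h1 := h.conj_denom_ne_zero
  have h2 : (Real.sin β : ℂ) ≠ 0 := by exact_mod_cast h.sin_right_pos.ne'
  have h3 : (Real.sin α * Real.sin β * (l ^ 2 + 1) : ℂ) = 2 * l * Real.cos α * Real.cos β := by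
    exact_mod_cast h.sin_mul_sin
  rw [h.coe_next, coe_imagPoint, map_div₀]
  simp only [map_add, map_sub, map_mul, Complex.conj_ofReal, Complex.conj_I, Complex.ofReal_div,
    Complex.ofReal_mul, Complex.ofReal_ofNat]
  rw [show (Real.cos α : ℂ) - l * Real.sin α * -Complex.I =
    Real.cos α + l * Real.sin α * Complex.I by ring]
  rw [eq_div_iff h1, mul_assoc, sub_mul, div_mul_cancel₀ _ h1, div_mul_eq_mul_div, eq_div_iff h2]
  linear_combination Complex.I * h3 - (Complex.I * l ^ 2 * Real.sin α * Real.sin β +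
    2 * l * Real.cos α * Real.sin β) * Complex.I_sq

theorem center_arg : -Complex.I * (((rotationAt 1 α one_ne_zero • imagPoint l h.pos : ℍ) : ℂ) -
      conj (imagPoint 1 one_pos : ℂ)) =
    (l + 1 : ℝ) * (Real.cos α - Real.sin α * Complex.I) /
      (Real.cos α - l * Real.sin α * Complex.I) := by
  have h1 := h.denom_ne_zero
  rw [h.coe_next, coe_imagPoint]
  simp only [map_mul, map_one, Complex.conj_I, Complex.ofReal_add, Complex.ofReal_one]
  rw [eq_div_iff h1, mul_assoc, sub_mul, div_mul_cancel₀ _ h1]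
  linear_combination (-(l : ℂ) * Real.cos α - Real.cos α + l * Real.sin α * Complex.I) * Complex.I_sq

/-- The triangle has angles `2α`, `β`, `β`, so this is half its area. The spoke on the imaginary
axis is parallel to the field and carries no flux; the numbers for the other two sides have product
of argument `π/2 - α - β`. -/
theorem triangleHalfFlux_eq : triangleHalfFlux (imagPoint 1 one_pos) (imagPoint l h.pos)
    (rotationAt 1 α one_ne_zero • imagPoint l h.pos) = Real.pi / 2 - α - β := by
  have h0 : halfFlux (imagPoint 1 one_pos) (imagPoint l h.pos) = 0 := by
    rw [halfFlux, coe_imagPoint, coe_imagPoint, Complex.arg_eq_zero_iff]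
    have := h.pos
    constructor <;> simp
    linarith
  have hb1 := abs_lt.mp (abs_halfFlux_lt (imagPoint l h.pos)
    (rotationAt 1 α one_ne_zero • imagPoint l h.pos))
  have hb2 := abs_lt.mp (abs_halfFlux_lt (rotationAt 1 α one_ne_zero • imagPoint l h.pos)
    (imagPoint 1 one_pos))
  rw [triangleHalfFlux, h0, zero_add]
  unfold halfFlux at *
  rw [← Complex.arg_mul (halfFlux_arg_ne_zero _ _) (halfFlux_arg_ne_zero _ _)
    ⟨by linarith, by linarith⟩, h.edge_arg, h.center_arg]
  have h1 := h.denom_ne_zero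
  have h2 := h.conj_denom_ne_zero
  have hN : ((Real.cos α : ℂ) + l * Real.sin α * Complex.I) *
      (Real.cos α - l * Real.sin α * Complex.I) =
      ((Real.cos α ^ 2 + l ^ 2 * Real.sin α ^ 2 : ℝ) : ℂ) := by
    push_cast
    linear_combination -(l : ℂ) ^ 2 * Complex.sin α ^ 2 * Complex.I_sq
  have hr : 0 < 2 * l * Real.cos α / Real.sin β * (l + 1) /
      (Real.cos α ^ 2 + l ^ 2 * Real.sin α ^ 2) := by
    have := h.pos
    have := h.cos_left_pos
    have := h.sin_right_pos
    have := h.normSq_pos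
    positivity
  have hα := h.pos_left
  have hβ := h.pos_right
  have hαβ := h.add_lt
  have hpi := Real.pi_pos
  rw [← Complex.arg_mul_cos_add_sin_mul_I hr (θ := Real.pi / 2 - α - β)
    ⟨by linarith, by linarith⟩, div_mul_div_comm, hN, ← Complex.ofReal_cos, ← Complex.ofReal_sin,
    show Real.pi / 2 - α - β = Real.pi / 2 - (α + β) by ring, Real.cos_pi_div_two_sub,
    Real.sin_pi_div_two_sub, Real.sin_add, Real.cos_add]
  congr 1
  simp only [Complex.ofReal_div, Complex.ofReal_mul, Complex.ofReal_add, Complex.ofReal_sub]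
  have e : ((Real.sin β : ℂ) + Real.cos β * Complex.I) * (Real.cos α - Real.sin α * Complex.I) =
      (Real.sin α * Real.cos β + Real.cos α * Real.sin β) +
        (Real.cos α * Real.cos β - Real.sin α * Real.sin β) * Complex.I := by
    linear_combination -(Real.sin α : ℂ) * Real.cos β * Complex.I_sq
  rw [← e]
  ring

/-- The right-triangle relation `cosh (side / 2) = cos α / sin β`. -/
theorem inv_cosh_half_dist : (Real.cosh (dist (imagPoint l h.pos)
    (rotationAt 1 α one_ne_zero • imagPoint l h.pos) / 2))⁻¹ = Real.sin β / Real.cos α := by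
  have hl := h.pos
  have hc := h.cos_left_pos
  have hs := h.sin_right_pos
  have hN := h.normSq_pos
  have hnorm : dist (imagPoint l h.pos : ℂ)
      (conj ((rotationAt 1 α one_ne_zero • imagPoint l h.pos : ℍ) : ℂ)) =
      2 * l * Real.cos α / Real.sin β / √(Real.cos α ^ 2 + l ^ 2 * Real.sin α ^ 2) := by
    have e := congrArg norm h.edge_arg
    have e1 : ‖(Real.sin β : ℂ) + Real.cos β * Complex.I‖ = 1 := by
      rw [Complex.norm_add_mul_I, Real.sin_sq_add_cos_sq, Real.sqrt_one]
    have e2 : ‖(Real.cos α : ℂ) + l * Real.sin α * Complex.I‖ =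
        √(Real.cos α ^ 2 + l ^ 2 * Real.sin α ^ 2) := by
      rw [← Complex.ofReal_mul, Complex.norm_add_mul_I, mul_pow]
    rw [norm_mul, norm_neg, Complex.norm_I, one_mul, norm_div, norm_mul, e1, e2, mul_one,
      Complex.norm_real, Real.norm_of_nonneg (by positivity)] at e
    rw [dist_eq_norm, e]
  have him : (imagPoint l h.pos).im = l := rfl
  rw [UpperHalfPlane.cosh_half_dist, hnorm, h.im_next, him, mul_div_assoc',
    Real.sqrt_div (by positivity), Real.sqrt_mul_self hl.le]
  have := Real.sqrt_pos.mpr hN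
  field_simp

theorem cos_halfFlux_ge (g : SL(2, ℝ)) : Real.sin β / Real.cos α ≤
    Real.cos (halfFlux (g • imagPoint l h.pos)
      (g • (rotationAt 1 α one_ne_zero • imagPoint l h.pos))) := by
  rw [← h.inv_cosh_half_dist, ← dist_smul g]
  exact inv_cosh_le_cos_halfFlux _ _

theorem halfFlux_le (g : SL(2, ℝ)) : halfFlux (g • imagPoint l h.pos)
      (g • (rotationAt 1 α one_ne_zero • imagPoint l h.pos)) ≤
    Real.arccos (Real.sin β / Real.cos α) := by
  refine (le_abs_self _).trans ?_
  rw [← Real.arccos_cos (abs_nonneg _) ((abs_halfFlux_lt _ _).le.trans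
    (by linarith [Real.pi_pos])), Real.cos_abs]
  exact Real.arccos_le_arccos (h.cos_halfFlux_ge g)

theorem sin_eq_zero_of_rotationAt_smul_eq {θ : ℝ}
    (hθ : rotationAt 1 θ one_ne_zero • imagPoint l h.pos = imagPoint l h.pos) :
    Real.sin θ = 0 := by
  have hd := UpperHalfPlane.denom_ne_zero (rotationAt 1 θ one_ne_zero : SL(2, ℝ))
    (imagPoint l h.pos)
  have e := congrArg UpperHalfPlane.coe hθ
  have h' : (-((1 : ℝ) : ℂ)⁻¹ * Real.sin θ * imagPoint l h.pos + Real.cos θ) ≠ 0 := by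
    rw [UpperHalfPlane.denom] at hd
    simpa [coe_rotationAt] using hd
  rw [coe_rotationAt_smul, div_eq_iff h', coe_imagPoint] at e
  have e' := congrArg Complex.re e
  simp [-Complex.ofReal_cos, -Complex.ofReal_sin] at e'
  have hl := h.one_lt
  have : Real.sin θ * (l ^ 2 - 1) = 0 := by linear_combination -e'
  exact (mul_eq_zero.mp this).resolve_right (by nlinarith)

/-- The vertex equation says precisely that the product of the two rotations has trace zero. -/
theorem rotationAt_mul_sq : (rotationAt 1 α one_ne_zero * rotationAt l β h.pos.ne') ^ 2 = -1 := by
  apply specialLinearGroup_sq_eq_neg_one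
  have hl := h.pos
  rw [Matrix.SpecialLinearGroup.coe_mul, coe_rotationAt, coe_rotationAt, Matrix.mul_fin_two]
  simp
  field_simp
  linear_combination -h.sin_mul_sin

end IsPolygonVertex

end Polygon

/-! ## The isoperimetric inequality of the tiling -/

section Isoperimetry

open UpperHalfPlane

open scoped MatrixGroups

theorem faceRot_mul_vertexRot_sq (p q : ℕ) : (faceRot p q * vertexRot p q) ^ 2 = 1 := by
  have h : (PresentedGroup.mk (vonDyckRels p q)) ((FreeGroup.of 0 * FreeGroup.of 1) ^ 2) = 1 :=
    PresentedGroup.one_of_mem (by simp [vonDyckRels])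
  simpa [faceRot, vertexRot, PresentedGroup.of] using h

theorem flipDart_flipDart {p q : ℕ} (g : Dart p q) : flipDart (flipDart g) = g := by
  rw [flipDart, flipDart, mul_assoc, ← sq, faceRot_mul_vertexRot_sq, mul_one]

/-- The group of orientation-preserving isometries of the upper half-plane. -/
abbrev moebiusGroup : Subgroup (Equiv.Perm ℍ) := (MulAction.toPermHom SL(2, ℝ) ℍ).range

/-- A matrix as a Möbius transformation. -/
abbrev toMoebius : SL(2, ℝ) →* moebiusGroup := (MulAction.toPermHom SL(2, ℝ) ℍ).rangeRestrict

theorem toMoebius_neg_one : toMoebius (-1) = 1 := by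
  apply Subtype.ext
  apply Equiv.ext
  intro z
  change (-1 : SL(2, ℝ)) • z = z
  apply UpperHalfPlane.ext
  rw [UpperHalfPlane.coe_specialLinearGroup_apply]
  simp

/-- The representation of the von Dyck group by isometries of the upper half-plane, for a polygon
with angles `2π / q` and central angles `2π / p`. -/
theorem exists_vonDyck_representation {p q : ℕ} (hp : 0 < p) (hq : 0 < q) {l : ℝ}
    (h : IsPolygonVertex (Real.pi / p) (Real.pi / q) l) :
    ∃ ρ : Dart p q →* moebiusGroup, ρ (faceRot p q) =
        toMoebius (rotationAt 1 (Real.pi / p) one_ne_zero) ∧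
      ρ (vertexRot p q) = toMoebius (rotationAt l (Real.pi / q) h.pos.ne') := by
  have hp' : (p : ℝ) ≠ 0 := by exact_mod_cast hp.ne'
  have hq' : (q : ℝ) ≠ 0 := by exact_mod_cast hq.ne'
  let f : Fin 2 → moebiusGroup := ![toMoebius (rotationAt 1 (Real.pi / p) one_ne_zero),
    toMoebius (rotationAt l (Real.pi / q) h.pos.ne')]
  -- In `SL(2, ℝ)` each relator equals `-1`, since `rotationAt` takes half of the rotation angle; it
  -- becomes trivial only as a Möbius transformation.
  have hf : ∀ r ∈ vonDyckRels p q, FreeGroup.lift f r = 1 := by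
    intro r hr
    simp only [vonDyckRels, Set.mem_insert_iff, Set.mem_singleton_iff] at hr
    rcases hr with rfl | rfl | rfl
    · rw [map_pow, FreeGroup.lift_apply_of]
      change toMoebius _ ^ p = 1
      rw [← map_pow, rotationAt_pow, mul_div_cancel₀ _ hp', rotationAt_pi, toMoebius_neg_one]
    · rw [map_pow, FreeGroup.lift_apply_of]
      change toMoebius _ ^ q = 1
      rw [← map_pow, rotationAt_pow, mul_div_cancel₀ _ hq', rotationAt_pi, toMoebius_neg_one]
    · rw [map_pow, map_mul, FreeGroup.lift_apply_of, FreeGroup.lift_apply_of]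
      change (toMoebius _ * toMoebius _) ^ 2 = 1
      rw [← map_mul, ← map_pow, h.rotationAt_mul_sq, toMoebius_neg_one]
  exact ⟨PresentedGroup.toGroup hf, PresentedGroup.toGroup.of hf, PresentedGroup.toGroup.of hf⟩

/-- A flow on the darts of the tiling with constant divergence `D` and capacity `M`. -/
structure IsTileFlow {p q : ℕ} (θ : Dart p q → ℝ) (D M : ℝ) : Prop where
  flip : ∀ g, θ (flipDart g) = -θ g
  le : ∀ g, θ g ≤ M
  sum_eq : ∀ g, ∑ i ∈ Finset.range p, θ (g * faceRot p q ^ i) = D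

/-- The dart `g` is sent to the oriented side from `ρ g v` to `ρ (g x) v`, where `v = i l`, and
carries the half flux through it. Cutting the tile into `p` central triangles shows that the
divergence is half its area. -/
theorem exists_isTileFlow {p q : ℕ} (hp : 0 < p) (hq : 0 < q) {l : ℝ}
    (h : IsPolygonVertex (Real.pi / p) (Real.pi / q) l) :
    ∃ θ : Dart p q → ℝ, IsTileFlow θ (p * (Real.pi / 2 - Real.pi / p - Real.pi / q))
      (Real.arccos (Real.sin (Real.pi / q) / Real.cos (Real.pi / p))) := by
  obtain ⟨ρ, hx, hy⟩ := exists_vonDyck_representation hp hq h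
  have hM : ∀ g, ∃ M : SL(2, ℝ), ∀ z, (ρ g : Equiv.Perm ℍ) z = M • z := fun g => by
    obtain ⟨M, hM⟩ := (ρ g).2
    exact ⟨M, fun z => by rw [← hM]; rfl⟩
  have hx' : ∀ z, (ρ (faceRot p q) : Equiv.Perm ℍ) z =
      rotationAt 1 (Real.pi / p) one_ne_zero • z := fun z => by rw [hx]; rfl
  have hy' : ∀ z, (ρ (vertexRot p q) : Equiv.Perm ℍ) z =
      rotationAt l (Real.pi / q) h.pos.ne' • z := fun z => by rw [hy]; rfl
  have hmul : ∀ g k z, (ρ (g * k) : Equiv.Perm ℍ) z = (ρ g : Equiv.Perm ℍ) ((ρ k : Equiv.Perm ℍ) z) :=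
    fun g k z => by rw [map_mul]; rfl
  have hvert : (ρ (vertexRot p q) : Equiv.Perm ℍ) (imagPoint l h.pos) = imagPoint l h.pos := by
    rw [hy', rotationAt_smul_imagPoint]
  -- As `y` fixes the vertex, flipping a dart interchanges the endpoints of its side.
  have hend : ∀ g, (ρ (flipDart g * faceRot p q) : Equiv.Perm ℍ) (imagPoint l h.pos) =
      (ρ g : Equiv.Perm ℍ) (imagPoint l h.pos) := fun g => by
    conv_lhs => rw [← hvert, ← hmul, mul_assoc, ← flipDart, flipDart_flipDart]
  have hstart : ∀ g, (ρ (flipDart g) : Equiv.Perm ℍ) (imagPoint l h.pos) =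
      (ρ (g * faceRot p q) : Equiv.Perm ℍ) (imagPoint l h.pos) := fun g => by
    rw [flipDart, ← mul_assoc, hmul, hvert]
  refine ⟨fun g => halfFlux ((ρ g : Equiv.Perm ℍ) (imagPoint l h.pos))
    ((ρ (g * faceRot p q) : Equiv.Perm ℍ) (imagPoint l h.pos)), fun g => ?_, fun g => ?_,
    fun g => ?_⟩
  · rw [hend, hstart, halfFlux_swap]
  · obtain ⟨M, hM⟩ := hM g
    rw [hmul, hx', hM, hM]
    exact h.halfFlux_le M
  · have hcenter : ∀ k : Dart p q, (ρ (k * faceRot p q) : Equiv.Perm ℍ) (imagPoint 1 one_pos) =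
        (ρ k : Equiv.Perm ℍ) (imagPoint 1 one_pos) := fun k => by
      rw [hmul, hx', rotationAt_smul_imagPoint]
    have hc : ∀ i : ℕ, (ρ (g * faceRot p q ^ i) : Equiv.Perm ℍ) (imagPoint 1 one_pos) =
        (ρ g : Equiv.Perm ℍ) (imagPoint 1 one_pos) := fun i => by
      induction i with
      | zero => rw [pow_zero, mul_one]
      | succ i ih => rw [pow_succ, ← mul_assoc, hcenter, ih]
    -- Each side is a central triangle minus two spokes. The spoke terms telescope around the tile
    -- and cancel because `x ^ p = 1`.
    have hterm : ∀ i : ℕ, halfFlux ((ρ (g * faceRot p q ^ i) : Equiv.Perm ℍ) (imagPoint l h.pos))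
        ((ρ (g * faceRot p q ^ i * faceRot p q) : Equiv.Perm ℍ) (imagPoint l h.pos)) =
        (Real.pi / 2 - Real.pi / p - Real.pi / q) +
        (halfFlux ((ρ g : Equiv.Perm ℍ) (imagPoint 1 one_pos))
          ((ρ (g * faceRot p q ^ (i + 1)) : Equiv.Perm ℍ) (imagPoint l h.pos)) -
        halfFlux ((ρ g : Equiv.Perm ℍ) (imagPoint 1 one_pos))
          ((ρ (g * faceRot p q ^ i) : Equiv.Perm ℍ) (imagPoint l h.pos))) := fun i => by
      obtain ⟨M, hM⟩ := hM (g * faceRot p q ^ i)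
      have e := h.triangleHalfFlux_eq
      rw [← triangleHalfFlux_smul M, ← hx', ← hM, ← hM, ← hM, ← hmul, hc, triangleHalfFlux] at e
      rw [← e, pow_succ, ← mul_assoc, halfFlux_swap ((ρ g : Equiv.Perm ℍ) (imagPoint 1 one_pos))
        ((ρ (g * faceRot p q ^ i * faceRot p q) : Equiv.Perm ℍ) (imagPoint l h.pos))]
      ring
    rw [Finset.sum_congr rfl fun i _ => hterm i, Finset.sum_add_distrib, Finset.sum_range_sub
      fun i => halfFlux ((ρ g : Equiv.Perm ℍ) (imagPoint 1 one_pos))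
          ((ρ (g * faceRot p q ^ i) : Equiv.Perm ℍ) (imagPoint l h.pos)), faceRot_pow, pow_zero, sub_self, add_zero, Finset.sum_const,
      Finset.card_range, nsmul_eq_mul]

/-- In the representation, a rotation about `i` by `2πk/p` moves the vertex `i l`. Hence a tile has
`p` distinct darts. -/
theorem faceRot_pow_ne_one {p q : ℕ} (hp : 0 < p) (hq : 0 < q) {l : ℝ}
    (h : IsPolygonVertex (Real.pi / p) (Real.pi / q) l) {k : ℕ} (hk : 0 < k) (hkp : k < p) :
    faceRot p q ^ k ≠ 1 := by
  intro h1
  obtain ⟨ρ, hx, -⟩ := exists_vonDyck_representation hp hq h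
  have e := congrArg (fun g => (ρ g : Equiv.Perm ℍ) (imagPoint l h.pos)) h1
  simp only [map_pow, hx, map_one] at e
  rw [← map_pow, rotationAt_pow] at e
  have e' : rotationAt 1 (k * (Real.pi / p)) one_ne_zero • imagPoint l h.pos =
    imagPoint l h.pos := e
  have hs := h.sin_eq_zero_of_rotationAt_smul_eq e'
  have hp' : (0 : ℝ) < p := by exact_mod_cast hp
  have hk' : (0 : ℝ) < k := by exact_mod_cast hk
  refine (Real.sin_pos_of_pos_of_lt_pi (by positivity) ?_).ne' hs
  rw [← mul_div_assoc, div_lt_iff₀ hp', mul_comm]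
  exact mul_lt_mul_of_pos_left (by exact_mod_cast hkp) Real.pi_pos

theorem sum_tileDarts {p q : ℕ} (hx : ∀ k : ℕ, 0 < k → k < p → faceRot p q ^ k ≠ 1)
    (f : Dart p q → ℝ) (t : Tile p q) :
    ∑ g ∈ tileDarts t, f g = ∑ i ∈ Finset.range p, f (Quotient.out t * faceRot p q ^ i) := by
  classical
  have hlt : ∀ i j : ℕ, i < j → j < p → faceRot p q ^ i ≠ faceRot p q ^ j := by
    intro i j hij hj he
    refine hx (j - i) (by omega) (by omega) ?_
    rw [← mul_right_inj (faceRot p q ^ i), ← pow_add, Nat.add_sub_cancel' hij.le, mul_one, he]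
  unfold tileDarts
  rw [Finset.sum_image]
  · intro i hi j hj hij
    have he := mul_left_cancel hij
    simp only [Finset.coe_range, Set.mem_Iio] at hi hj
    rcases lt_trichotomy i j with h | h | h
    · exact absurd he (hlt i j h hj)
    · exact h
    · exact absurd he.symm (hlt j i h hi)

theorem mem_biUnion_tileDarts {p q : ℕ} (hp : 0 < p) [DecidableEq (Dart p q)]
    (B : Finset (Tile p q)) (g : Dart p q) : g ∈ B.biUnion tileDarts ↔ tileOf g ∈ B := by
  simp only [Finset.mem_biUnion, mem_tileDarts hp]
  exact ⟨fun ⟨t, ht, h⟩ => h ▸ ht, fun h => ⟨_, h, rfl⟩⟩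

/-- Discrete divergence theorem: the total divergence of the patch leaves through its external
edges, each of capacity `M`. -/
theorem IsTileFlow.card_mul_le {p q : ℕ} (hp : 0 < p)
    (hx : ∀ k : ℕ, 0 < k → k < p → faceRot p q ^ k ≠ 1) {θ : Dart p q → ℝ} {D M : ℝ}
    (h : IsTileFlow θ D M) (B : Finset (Tile p q)) : B.card * D ≤ numSites B * M := by
  classical
  have hmem := mem_biUnion_tileDarts (q := q) hp B
  have htot : ∑ g ∈ B.biUnion tileDarts, θ g = B.card * D := by
    rw [Finset.sum_biUnion, Finset.sum_congr rfl fun t _ => by rw [sum_tileDarts hx, h.sum_eq]]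
    · simp
    · intro s _ t _ hst
      refine Finset.disjoint_left.mpr fun g hs ht => hst ?_
      rw [← (mem_tileDarts hp s g).mp hs, (mem_tileDarts hp t g).mp ht]
  -- The flip permutes the internal darts and negates the flow, so the sum equals its own negative.
  have hint : ∑ g ∈ (B.biUnion tileDarts).filter (fun g => ¬ tileOf (flipDart g) ∉ B), θ g = 0 := by
    have hflip : ∑ g ∈ (B.biUnion tileDarts).filter (fun g => ¬ tileOf (flipDart g) ∉ B), θ g =
        ∑ g ∈ (B.biUnion tileDarts).filter (fun g => ¬ tileOf (flipDart g) ∉ B), -θ g := by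
      refine Finset.sum_nbij' flipDart flipDart ?_ ?_ (fun g _ => flipDart_flipDart g)
        (fun g _ => flipDart_flipDart g) (fun g _ => by rw [h.flip, neg_neg])
      all_goals
        intro g hg
        rw [Finset.mem_filter, hmem, not_not] at hg ⊢
        rw [flipDart_flipDart]
        exact hg.symm
    rw [Finset.sum_neg_distrib] at hflip
    linarith
  rw [← Finset.sum_filter_add_sum_filter_not _ (fun g => tileOf (flipDart g) ∉ B), hint,
    add_zero] at htot
  rw [← htot, numSites, ← nsmul_eq_mul]
  refine (Finset.sum_le_card_nsmul _ _ M fun g _ => h.le g).trans (le_of_eq ?_)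
  congr 1

end Isoperimetry

/-! ## The boundary of a patch exceeds its area -/

theorem IsHyperbolicSymbol.pi_div_add_pi_div_lt {p q : ℕ} (h : IsHyperbolicSymbol p q) :
    Real.pi / p + Real.pi / q < Real.pi / 2 := by
  have := mul_lt_mul_of_pos_left h.2.2 Real.pi_pos
  calc Real.pi / p + Real.pi / q = Real.pi * (1 / p + 1 / q) := by ring
    _ < _ := by linarith

theorem IsHyperbolicSymbol.two_mul_add_lt_mul {p q : ℕ} (h : IsHyperbolicSymbol p q) :
    2 * p + 2 * q < p * q := by
  obtain ⟨hp, hq, h⟩ := h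
  have hp' : (0 : ℝ) < p := by exact_mod_cast (by omega : 0 < p)
  have hq' : (0 : ℝ) < q := by exact_mod_cast (by omega : 0 < q)
  rw [div_add_div _ _ hp'.ne' hq'.ne', div_lt_div_iff₀ (by positivity) two_pos] at h
  have : (2 * p + 2 * q : ℝ) < p * q := by linarith
  exact_mod_cast this

/-- The inequality is equivalent to `π/2 - π/q ≤ D`, with `D` half the area of a tile; for `p > 3`
only `{4, 5}` violates it. -/
theorem IsHyperbolicSymbol.eq_four_five_or_le {p q : ℕ} (h : IsHyperbolicSymbol p q) (hp : 3 < p) :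
    (p = 4 ∧ q = 5) ∨ 2 * (p - 1 : ℝ) ≤ q * (p - 3) := by
  have h1 := h.two_mul_add_lt_mul
  have hq := h.2.1
  by_cases h45 : p = 4 ∧ q = 5
  · exact Or.inl h45
  right
  obtain ⟨m, rfl⟩ : ∃ m, p = m + 4 := ⟨p - 4, by omega⟩
  have key : 2 * (m + 3) ≤ q * (m + 1) := by
    rcases m with _ | _ | _ | m
    · omega
    · omega
    · omega
    · nlinarith
  have key' : (2 * (m + 3) : ℝ) ≤ q * (m + 1) := by exact_mod_cast key
  push_cast
  linarith

theorem IsHyperbolicSymbol.arccos_lt {p q : ℕ} (h : IsHyperbolicSymbol p q) (hp : 3 < p) :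
    Real.arccos (Real.sin (Real.pi / q) / Real.cos (Real.pi / p)) <
      p * (Real.pi / 2 - Real.pi / p - Real.pi / q) := by
  have hp0 : (0 : ℝ) < p := by exact_mod_cast (by omega : 0 < p)
  have hq0 : (0 : ℝ) < q := by exact_mod_cast (by have := h.2.1; omega : 0 < q)
  have hpi := Real.pi_pos
  have hα : 0 < Real.pi / p := by positivity
  have hβ : 0 < Real.pi / q := by positivity
  have hlt := h.pi_div_add_pi_div_lt
  have hcos : 0 < Real.cos (Real.pi / p) := Real.cos_pos_of_mem_Ioo ⟨by linarith, by linarith⟩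
  have hsin : 0 < Real.sin (Real.pi / q) := Real.sin_pos_of_pos_of_lt_pi hβ (by linarith)
  have hle : Real.sin (Real.pi / q) / Real.cos (Real.pi / p) ≤ 1 := by
    rw [div_le_one hcos, ← Real.sin_pi_div_two_sub]
    exact Real.sin_le_sin_of_le_of_le_pi_div_two (by linarith) (by linarith) (by linarith)
  rcases h.eq_four_five_or_le hp with ⟨rfl, rfl⟩ | hpq
  -- For `{4, 5}` the margin is narrow: `D = π/5`, and the claim amounts to `3 cos² (π/5) < 2`.
  · have h5 : Real.sqrt 5 ^ 2 = 5 := Real.sq_sqrt (by norm_num)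
    have hc5 := Real.cos_pi_div_five
    have hs5 := Real.sin_sq_add_cos_sq (Real.pi / 5)
    rw [show ((4 : ℕ) : ℝ) * (Real.pi / 2 - Real.pi / (4 : ℕ) - Real.pi / (5 : ℕ)) = Real.pi / 5 by
      push_cast; ring]
    rw [← Real.arccos_cos (x := Real.pi / 5) (by positivity) (by linarith)]
    refine Real.arccos_lt_arccos (Real.neg_one_le_cos _) ?_ hle
    push_cast at hsin hcos ⊢
    rw [lt_div_iff₀ hcos]
    refine lt_of_pow_lt_pow_left₀ 2 hsin.le ?_
    have h4 : Real.cos (Real.pi / 4) ^ 2 = 1 / 2 := by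
      rw [Real.cos_pi_div_four, div_pow, Real.sq_sqrt (by norm_num)]; norm_num
    rw [mul_pow, h4]
    rw [hc5] at hs5 ⊢
    nlinarith [Real.sqrt_nonneg 5]
  -- Dropping the factor `1 / cos (π/p) > 1` replaces the capacity by the larger `arccos (sin (π/q))
  -- = π/2 - π/q`.
  · refine lt_of_lt_of_le (b := Real.pi / 2 - Real.pi / q) ?_ ?_
    · rw [← Real.arccos_cos (x := Real.pi / 2 - Real.pi / q) (by linarith) (by linarith),
        Real.cos_pi_div_two_sub]
      refine Real.arccos_lt_arccos (by linarith [Real.neg_one_le_sin (Real.pi / q)]) ?_ hle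
      rw [lt_div_iff₀ hcos]
      refine mul_lt_of_lt_one_right hsin ?_
      rw [← Real.cos_zero]
      exact Real.cos_lt_cos_of_nonneg_of_le_pi_div_two le_rfl (by linarith) hα
    · have e : p * (Real.pi / 2 - Real.pi / p - Real.pi / q) - (Real.pi / 2 - Real.pi / q) =
          Real.pi * (q * (p - 3) - 2 * (p - 1)) / (2 * q) := by
        field_simp
        ring
      have : 0 ≤ Real.pi * (q * (p - 3) - 2 * (p - 1)) / (2 * q) :=
        div_nonneg (mul_nonneg hpi.le (by linarith)) (by positivity)
      linarith

theorem IsHyperbolicSymbol.exists_card_le {p q : ℕ} (h : IsHyperbolicSymbol p q) (hp : 3 < p) :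
    ∃ κ : ℝ, 0 ≤ κ ∧ κ < 1 ∧ ∀ B : Finset (Tile p q), (B.card : ℝ) ≤ κ * numSites B := by
  have hp0 : 0 < p := by omega
  have hq0 : 0 < q := by have := h.2.1; omega
  obtain ⟨l, hl⟩ := exists_isPolygonVertex (α := Real.pi / p) (β := Real.pi / q)
    (div_pos Real.pi_pos (by exact_mod_cast hp0)) (div_pos Real.pi_pos (by exact_mod_cast hq0))
    h.pi_div_add_pi_div_lt
  obtain ⟨θ, hθ⟩ := exists_isTileFlow hp0 hq0 hl
  have hlt := h.arccos_lt hp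
  have hM := Real.arccos_nonneg (Real.sin (Real.pi / q) / Real.cos (Real.pi / p))
  have hD := hM.trans_lt hlt
  refine ⟨_, div_nonneg hM hD.le, (div_lt_one hD).mpr hlt, fun B => ?_⟩
  have hB := hθ.card_mul_le hp0 (fun k hk hkp => faceRot_pow_ne_one hp0 hq0 hl hk hkp) B
  rw [div_mul_eq_mul_div, le_div_iff₀ hD]
  linarith

/-! ## Layered patches -/

theorem mem_inflate {p q : ℕ} (hp : 0 < p) (B : Finset (Tile p q)) (t : Tile p q) :
    t ∈ inflate B ↔ ∃ g : Dart p q, tileOf g ∈ B ∧ ∃ j < q, tileOf (g * vertexRot p q ^ j) = t := by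
  classical
  unfold inflate
  simp only [Finset.mem_biUnion (s := B.biUnion tileDarts), mem_biUnion_tileDarts hp B,
    Finset.mem_image, Finset.mem_range]

theorem exists_tileOf_eq {p q : ℕ} (t : Tile p q) : ∃ g : Dart p q, tileOf g = t :=
  ⟨_, Quotient.out_eq t⟩

theorem subset_inflate {p q : ℕ} (hp : 0 < p) (hq : 0 < q) (B : Finset (Tile p q)) :
    B ⊆ inflate B := by
  intro t ht
  obtain ⟨g, rfl⟩ := exists_tileOf_eq t
  exact (mem_inflate hp B _).mpr ⟨g, ht, 0, hq, by rw [pow_zero, mul_one]⟩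

theorem tileOf_mul_faceRot {p q : ℕ} (g : Dart p q) : tileOf (g * faceRot p q) = tileOf g :=
  QuotientGroup.mk_mul_of_mem g (Subgroup.mem_zpowers _)

theorem tileOf_flipDart_mem_inflate {p q : ℕ} (hp : 0 < p) (hq : 1 < q) {B : Finset (Tile p q)}
    {g : Dart p q} (hg : tileOf g ∈ B) : tileOf (flipDart g) ∈ inflate B :=
  (mem_inflate hp B _).mpr ⟨g * faceRot p q, by rwa [tileOf_mul_faceRot], 1, hq, by
    rw [pow_one, flipDart, mul_assoc]⟩

theorem numSites_eq_zero_of_inflate_eq {p q : ℕ} (hp : 0 < p) (hq : 1 < q) {B : Finset (Tile p q)}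
    (h : inflate B = B) : numSites B = 0 := by
  classical
  rw [numSites, Finset.card_eq_zero, Finset.eq_empty_iff_forall_notMem]
  intro g hg
  obtain ⟨-, hg2⟩ := Finset.mem_filter.mp hg
  refine hg2 ?_
  have hmem := tileOf_flipDart_mem_inflate hp hq (tileOf_mem_of_mem_externalEdges B ⟨g, hg⟩)
  rwa [h] at hmem

theorem tileGraph_adj_or_eq {p q : ℕ} (g : Dart p q) :
    tileOf g = tileOf (g * vertexRot p q) ∨
      (tileGraph p q).Adj (tileOf g) (tileOf (g * vertexRot p q)) := by
  by_cases h : tileOf g = tileOf (g * vertexRot p q)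
  · exact Or.inl h
  -- The dart `g x⁻¹` lies in the tile of `g`, and its flip is `g x⁻¹ x y = g y`.
  · refine Or.inr ⟨h, Or.inl ⟨g * (faceRot p q)⁻¹, ?_, ?_⟩⟩
    · rw [← tileOf_mul_faceRot, inv_mul_cancel_right]
    · rw [flipDart, ← mul_assoc, inv_mul_cancel_right]

theorem patchGraph_reachable_of_eq_or_adj {p q : ℕ} {B : Finset (Tile p q)} {s t : B}
    (h : (s : Tile p q) = t ∨ (tileGraph p q).Adj s t) : (patchGraph B).Reachable s t := by
  rcases h with h | h
  · rw [Subtype.ext h]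
  · exact SimpleGraph.Adj.reachable (G := patchGraph B) h

/-- Turning around a vertex of an old tile passes through equal or adjacent tiles, all in the
inflated patch, so every new tile is joined to an old one. -/
theorem patchGraph_inflate_connected {p q : ℕ} (hp : 0 < p) (hq : 0 < q) {B : Finset (Tile p q)}
    (hB : (patchGraph B).Connected) : (patchGraph (inflate B)).Connected := by
  have hsub := subset_inflate hp hq B
  have hrot : ∀ (g : Dart p q) (hg : tileOf g ∈ B) (j : ℕ) (hj : j < q),
      ∃ hm : tileOf (g * vertexRot p q ^ j) ∈ inflate B,
        (patchGraph (inflate B)).Reachable ⟨tileOf g, hsub hg⟩ ⟨_, hm⟩ := by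
    intro g hg j
    induction j with
    | zero =>
      intro _
      simp only [pow_zero, mul_one]
      exact ⟨hsub hg, SimpleGraph.Reachable.refl _⟩
    | succ j ih =>
      intro hj
      obtain ⟨hm, hr⟩ := ih (by omega)
      have hm' : tileOf (g * vertexRot p q ^ (j + 1)) ∈ inflate B :=
        (mem_inflate hp B _).mpr ⟨g, hg, j + 1, hj, rfl⟩
      refine ⟨hm', hr.trans (patchGraph_reachable_of_eq_or_adj ?_)⟩
      have := tileGraph_adj_or_eq (g * vertexRot p q ^ j)
      rwa [mul_assoc, ← pow_succ] at this
  have hin : ∀ s t : B, (patchGraph (inflate B)).Reachable ⟨s, hsub s.2⟩ ⟨t, hsub t.2⟩ :=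
    fun s t => (hB.preconnected s t).map
      (⟨fun s => ⟨s, hsub s.2⟩, fun h => h⟩ : patchGraph B →g patchGraph (inflate B))
  have hout : ∀ t : inflate B, ∃ s : B, (patchGraph (inflate B)).Reachable ⟨s, hsub s.2⟩ t := by
    rintro ⟨t, ht⟩
    obtain ⟨g, hg, j, hj, rfl⟩ := (mem_inflate hp B t).mp ht
    obtain ⟨_, hr⟩ := hrot g hg j hj
    exact ⟨⟨tileOf g, hg⟩, hr⟩
  obtain ⟨s₀⟩ := hB.nonempty
  refine (SimpleGraph.connected_iff _).mpr ⟨fun t t' => ?_, ⟨⟨s₀, hsub s₀.2⟩⟩⟩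
  obtain ⟨s, hs⟩ := hout t
  obtain ⟨s', hs'⟩ := hout t'
  exact hs.symm.trans ((hin s s').trans hs')

theorem layeredPatch_succ (p q L : ℕ) : layeredPatch p q (L + 1) = inflate (layeredPatch p q L) :=
  Function.iterate_succ_apply' _ _ _

theorem patchGraph_layeredPatch_connected {p q : ℕ} (hp : 0 < p) (hq : 0 < q) (L : ℕ) :
    (patchGraph (layeredPatch p q L)).Connected := by
  induction L with
  | zero =>
    have hs : Subsingleton (layeredPatch p q 0) := ⟨fun s t => Subtype.ext <| by
      rw [Finset.mem_singleton.mp s.2, Finset.mem_singleton.mp t.2]⟩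
    refine (SimpleGraph.connected_iff _).mpr ⟨fun s t => ?_, ⟨⟨tileOf 1, Finset.mem_singleton_self _⟩⟩⟩
    rw [Subsingleton.elim s t]
  | succ L ih =>
    rw [layeredPatch_succ]
    exact patchGraph_inflate_connected hp hq ih

/-- A patch fixed by inflation would have no external edge, which the isoperimetric inequality
forbids for a nonempty patch; so each layer adds at least one tile. -/
theorem IsHyperbolicSymbol.lt_card_layeredPatch {p q : ℕ} (h : IsHyperbolicSymbol p q) (hp : 3 < p)
    (L : ℕ) : L < (layeredPatch p q L).card := by
  have hq := h.2.1
  obtain ⟨κ, -, -, hκ⟩ := h.exists_card_le hp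
  induction L with
  | zero => exact Finset.card_pos.mpr ⟨tileOf 1, Finset.mem_singleton_self _⟩
  | succ L ih =>
    refine lt_of_le_of_lt ih (Finset.card_lt_card ?_)
    rw [layeredPatch_succ]
    refine (subset_inflate (by omega) (by omega) _).ssubset_of_ne fun he => ?_
    have h0 := hκ (layeredPatch p q L)
    rw [numSites_eq_zero_of_inflate_eq (by omega) (by omega) he.symm] at h0
    have : (0 : ℝ) < (layeredPatch p q L).card := by exact_mod_cast (Nat.zero_le L).trans_lt ih
    rw [Nat.cast_zero, mul_zero] at h0
    linarith

theorem IsHyperbolicSymbol.card_le_numSites {p q : ℕ} (h : IsHyperbolicSymbol p q) (hp : 3 < p)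
    (B : Finset (Tile p q)) : B.card ≤ numSites B := by
  obtain ⟨κ, -, hκ1, hκ⟩ := h.exists_card_le hp
  have : (B.card : ℝ) ≤ numSites B :=
    (hκ B).trans (mul_le_of_le_one_left (Nat.cast_nonneg _) hκ1.le)
  exact_mod_cast this

/-! ## Equilibration -/

theorem patchInvEffDim_nonneg {p q : ℕ} (B : Finset (Tile p q)) (a b d : ℕ)
    (ref : (v : B) → EuclideanSpace ℂ (LegIndex (patchGraph B) (patchSite B) a b d v))
    (Φ : EuclideanSpace ℂ (B → Fin d)) (φ : EuclideanSpace ℂ (externalEdges B → Fin a)) :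
    0 ≤ patchInvEffDim B a b d ref Φ φ :=
  div_nonneg (mul_nonneg (by positivity) (integral_nonneg fun _ => by positivity)) (sq_nonneg _)

theorem patchInvEffDim_le {p q : ℕ} (B : Finset (Tile p q)) {a b d : ℕ} (ha : 1 ≤ a) (hb : 1 ≤ b)
    (hd : 1 ≤ d) (ref : (v : B) → EuclideanSpace ℂ (LegIndex (patchGraph B) (patchSite B) a b d v))
    (Φ : EuclideanSpace ℂ (B → Fin d)) (φ : EuclideanSpace ℂ (externalEdges B → Fin a))
    (h : AreUnitVectors (patchGraph B) (patchSite B) a b d ref Φ φ) :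
    patchInvEffDim B a b d ref Φ φ ≤ 2 ^ B.card / (a : ℝ) ^ numSites B := by
  have := invEffDim_le (patchGraph B) (patchSite B) a b d ha hb hd ref Φ φ h
  rwa [Fintype.card_coe, Fintype.card_coe] at this

/-- The bound is geometric in `n` with ratio `2^(κ-1) < 1`, so `N` depends on `p`, `q` and `ε` only.
-/
theorem IsHyperbolicSymbol.exists_patchInvEffDim_lt {p q : ℕ} (h : IsHyperbolicSymbol p q)
    (hp : 3 < p) {a : ℕ} (ha : 2 ≤ a) {ε : ℝ} (hε : 0 < ε) :
    ∃ N : ℕ, ∀ B : Finset (Tile p q), N ≤ numSites B → ∀ b d : ℕ, 1 ≤ b → 1 ≤ d →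
      ∀ (ref : (v : B) → EuclideanSpace ℂ (LegIndex (patchGraph B) (patchSite B) a b d v))
        (Φ : EuclideanSpace ℂ (B → Fin d)) (φ : EuclideanSpace ℂ (externalEdges B → Fin a)),
        AreUnitVectors (patchGraph B) (patchSite B) a b d ref Φ φ →
        patchInvEffDim B a b d ref Φ φ < ε := by
  obtain ⟨κ, -, hκ1, hκ⟩ := h.exists_card_le hp
  have hc0 : (0 : ℝ) < 2 ^ (κ - 1) := by positivity
  have hc1 : (2 : ℝ) ^ (κ - 1) < 1 := Real.rpow_lt_one_of_one_lt_of_neg one_lt_two (by linarith)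
  obtain ⟨N, hN⟩ := exists_pow_lt_of_lt_one hε hc1
  refine ⟨N, fun B hB b d hb hd ref Φ φ hu => ?_⟩
  calc patchInvEffDim B a b d ref Φ φ ≤ 2 ^ B.card / (a : ℝ) ^ numSites B :=
        patchInvEffDim_le B (by omega) hb hd ref Φ φ hu
    _ ≤ 2 ^ B.card / (2 : ℝ) ^ numSites B := by
        gcongr
        exact_mod_cast ha
    _ = (2 : ℝ) ^ ((B.card : ℝ) - numSites B) := by
        rw [Real.rpow_sub two_pos, Real.rpow_natCast, Real.rpow_natCast]
    _ ≤ (2 : ℝ) ^ ((κ - 1) * numSites B) :=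
        Real.rpow_le_rpow_of_exponent_le one_le_two (by linarith [hκ B])
    _ = ((2 : ℝ) ^ (κ - 1)) ^ numSites B := by rw [Real.rpow_mul two_pos.le, Real.rpow_natCast]
    _ ≤ ((2 : ℝ) ^ (κ - 1)) ^ N := pow_le_pow_of_le_one hc0.le hc1.le hB
    _ < ε := hN

theorem IsHyperbolicSymbol.tendsto_numSites_layeredPatch {p q : ℕ} (h : IsHyperbolicSymbol p q)
    (hp : 3 < p) : Tendsto (fun L => numSites (layeredPatch p q L)) atTop atTop :=
  tendsto_atTop_mono (fun L => (h.lt_card_layeredPatch hp L).le.trans (h.card_le_numSites hp _))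
    tendsto_id

end

/-! ### Uniform equilibration and its consequence for layered patches -/

theorem mainTheorem5 (p q : ℕ) (hpq : IsHyperbolicSymbol p q) (hp : 3 < p)
    (a : ℕ) (ha : 2 ≤ a) :
    -- `1 / D_eff → 0` as `n → ∞`, uniformly in the bond and logical dimensions, for all patches
    (∀ ε : ℝ, 0 < ε → ∃ N : ℕ, ∀ B : Finset (Tile p q), (patchGraph B).Connected →
      N ≤ numSites B → ∀ b d : ℕ, 1 ≤ b → 1 ≤ d →
      ∀ (ref : (v : B) → EuclideanSpace ℂ (LegIndex (patchGraph B) (patchSite B) a b d v))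
        (Φ : EuclideanSpace ℂ (B → Fin d)) (φ : EuclideanSpace ℂ (externalEdges B → Fin a)),
        AreUnitVectors (patchGraph B) (patchSite B) a b d ref Φ φ →
        patchInvEffDim B a b d ref Φ φ < ε) ∧
    -- the layered patches of the tiling have `n → ∞`, and `1 / D_eff → 0` along them
    (∀ L, (patchGraph (layeredPatch p q L)).Connected) ∧
    Tendsto (fun L => numSites (layeredPatch p q L)) atTop atTop ∧
    (∀ b d : ℕ → ℕ, (∀ L, 1 ≤ b L) → (∀ L, 1 ≤ d L) →
      ∀ (ref : (L : ℕ) → (v : layeredPatch p q L) →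
          EuclideanSpace ℂ (LegIndex (patchGraph (layeredPatch p q L))
            (patchSite (layeredPatch p q L)) a (b L) (d L) v))
        (Φ : (L : ℕ) → EuclideanSpace ℂ (layeredPatch p q L → Fin (d L)))
        (φ : (L : ℕ) → EuclideanSpace ℂ (externalEdges (layeredPatch p q L) → Fin a)),
        (∀ L, AreUnitVectors (patchGraph (layeredPatch p q L)) (patchSite (layeredPatch p q L))
          a (b L) (d L) (ref L) (Φ L) (φ L)) →
        Tendsto (fun L => patchInvEffDim (layeredPatch p q L) a (b L) (d L) (ref L) (Φ L) (φ L))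
          atTop (𝓝 0)) := by
  have hq := hpq.2.1
  have hlim := hpq.tendsto_numSites_layeredPatch hp
  refine ⟨fun ε hε => ?_, patchGraph_layeredPatch_connected (by omega) (by omega), hlim,
    fun b d hb hd ref Φ φ hu => ?_⟩
  · obtain ⟨N, hN⟩ := hpq.exists_patchInvEffDim_lt hp ha hε
    exact ⟨N, fun B _ hB => hN B hB⟩
  · refine tendsto_order.mpr ⟨fun ε hε => .of_forall fun L =>
      hε.trans_le (patchInvEffDim_nonneg _ _ _ _ _ _ _), fun ε hε => ?_⟩
    obtain ⟨N, hN⟩ := hpq.exists_patchInvEffDim_lt hp ha hε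
    filter_upwards [hlim.eventually_ge_atTop N] with L hL
    exact hN _ hL _ _ (hb L) (hd L) _ _ _ (hu L)
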